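/- Let $\mathbb{H}_{\mathbb{C}}$ be the algebra of biquaternions $p=p_0+\sum_{k=1}^3p_ke_k$, $p_k\in\mathbb{C}$ (with $e_0=1$, $e_1^2=e_2^2=e_3^2=-1$, $e_1e_2=-e_2e_1=e_3$, etc., and the complex unit commuting with the $e_k$), with conjugation $\overline{p}=p_0-\sum_{k=1}^3p_ke_k$, inner product $\langle p,q\rangle=\sum_{k=0}^3p_k^*q_k$ ($^*$ is complex conjugation) and the corresponding norm. Let $G\subset\mathbb{R}^3$ be a bounded domain, and let $L_2(G;\mathbb{H}_{\mathbb{C}})$ carry the inner product $\langle u,v\rangle_{L_2}=\int_G\langle u(t),v(t)\rangle\,dV_t$. Let $A=(a_1,a_2,a_3,a_4)\in L_\infty(G;\mathbb{H}_{\mathbb{C}})^4$, put $\mathbf{Q}_Aw=wa_1+\overline{w}a_2+a_3w+a_4\overline{w}$ and $\mathbf{D}=\sum_{k=1}^3e_k\partial_{x_k}$, and let $\mathfrak{V}_A^2$ be the space of all weak solutions $w\in L_2(G;\mathbb{H}_{\mathbb{C}})$ of $\mathbf{D}w=\mathbf{Q}_Aw$ in $G$, that is, of all $w\in L_2(G;\mathbb{H}_{\mathbb{C}})$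 with $$\int_G\overline{w}\,(\mathbf{D}\varphi)\,dV=\int_G\overline{\mathbf{Q}_Aw}\;\varphi\,dV\qquad\text{for all }\varphi\in C_0^\infty(G;\mathbb{H}_{\mathbb{C}}).$$ This is a closed complex subspace of $L_2(G;\mathbb{H}_{\mathbb{C}})$; let $\mathbf{P}_G^A$ be the orthogonal projection of $L_2(G;\mathbb{H}_{\mathbb{C}})$ onto it. Then: 1. Every $w\in\mathfrak{V}_A^2$ has a representative that is continuous on $G$, and this representative is unique on $G$. For $w\in\mathfrak{V}_A^2$ and $x\in G$, $w(x)$ denotes its value at $x$ and $w_k(x)$ the components of that value. 2. For every $x\in G$ the evaluation $\mathfrak{V}_A^2\ni w\mapsto w(x)\in\mathbb{H}_{\mathbb{C}}$ is complex linear and bounded in the $L_2$-norm. 3. For every $x\in G$ and $k=0,1,2,3$ there is a unique $K_x^k\in\mathfrak{V}_A^2$ with $w_k(x)=\langle K_x^k,w\rangle_{L_2}$ for all $w\in\mathfrak{V}_A^2$. 4. Define the Vekua–Bergman kernel by $\mathscr{K}_G^A(x,t;a)=\sum_{j=0}^3K_t^j(x)\,a_j$ for $x,t\in G$ and $a\in\mathbb{H}_{\mathbb{C}}$.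 Then for every $u\in L_2(G;\mathbb{H}_{\mathbb{C}})$ and every $x\in G$ the function $t\mapsto\mathscr{K}_G^A(x,t;u(t))$ is integrable over $G$ and $$\mathbf{P}_G^Au(x)=\int_G\mathscr{K}_G^A(x,t;u(t))\,dV_t .$$ -/

import Mathlib

open MeasureTheory
open scoped ENNReal ContDiff

noncomputable section

namespace VekuaBergman

/-! ### Biquaternions -/

/-- Three dimensional Euclidean space. -/
abbrev E3 : Type := EuclideanSpace ℝ (Fin 3)

/-- The biquaternions `p = p₀ + p₁ e₁ + p₂ e₂ + p₃ e₃` with complex components, carrying the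
inner product `⟨p, q⟩ = ∑ₖ pₖ^* qₖ` (conjugate linear in the first slot) and its norm. -/
abbrev HC : Type := EuclideanSpace ℂ (Fin 4)

/-- A biquaternion as an element of Mathlib's quaternion algebra over `ℂ`. -/
def toQuat (p : HC) : Quaternion ℂ := ⟨p 0, p 1, p 2, p 3⟩

/-- The biquaternion with the components of a given complex quaternion. -/
def ofQuat (q : Quaternion ℂ) : HC := !₂[q.re, q.imI, q.imJ, q.imK]

/-- The (noncommutative) product of biquaternions. -/
def hmul (p q : HC) : HC := ofQuat (toQuat p * toQuat q)

/-- Quaternionic conjugation `p₀ + p⃗ ↦ p₀ - p⃗` (no complex conjugation is involved). -/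
def hconj (p : HC) : HC := ofQuat (star (toQuat p))

/-- The quaternionic units `e₀ = 1, e₁, e₂, e₃`. -/
def eUnit (k : Fin 4) : HC := EuclideanSpace.single k 1

lemma hmul_eq (p q : HC) : hmul p q =
    !₂[p 0 * q 0 - p 1 * q 1 - p 2 * q 2 - p 3 * q 3,
       p 0 * q 1 + p 1 * q 0 + p 2 * q 3 - p 3 * q 2,
       p 0 * q 2 - p 1 * q 3 + p 2 * q 0 + p 3 * q 1,
       p 0 * q 3 + p 1 * q 2 - p 2 * q 1 + p 3 * q 0] := by
  ext i
  fin_cases i <;>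
    simp [hmul, ofQuat, Quaternion.re_mul, Quaternion.imI_mul, Quaternion.imJ_mul,
      Quaternion.imK_mul] <;> simp [toQuat]

lemma hconj_eq (p : HC) : hconj p = !₂[p 0, -p 1, -p 2, -p 3] := by
  ext i
  fin_cases i <;>
    simp [hconj, ofQuat, Quaternion.re_star, Quaternion.imI_star, Quaternion.imJ_star,
      Quaternion.imK_star] <;> simp [toQuat]

/-- The product as a continuous bilinear map. -/
def hmulL : HC →L[ℂ] HC →L[ℂ] HC :=
  LinearMap.toContinuousLinearMap
    (LinearMap.toContinuousLinearMap.toLinearMap ∘ₗ LinearMap.mk₂ ℂ hmul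
      (by intro a b c; ext i; fin_cases i <;> simp [hmul_eq] <;> ring)
      (by intro a b c; ext i; fin_cases i <;> simp [hmul_eq] <;> ring)
      (by intro a b c; ext i; fin_cases i <;> simp [hmul_eq] <;> ring)
      (by intro a b c; ext i; fin_cases i <;> simp [hmul_eq] <;> ring))

@[simp] lemma hmulL_apply (p q : HC) : hmulL p q = hmul p q := rfl

/-- Quaternionic conjugation as a continuous linear map. -/
def hconjL : HC →L[ℂ] HC :=
  LinearMap.toContinuousLinearMap
    { toFun := hconj
      map_add' := by
        intro a b; ext i; fin_cases i <;> simp [hconj_eq] <;> ring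
      map_smul' := by
        intro c a; ext i; fin_cases i <;> simp [hconj_eq] }

@[simp] lemma hconjL_apply (p : HC) : hconjL p = hconj p := rfl

/-! ### The Moisil-Theodorescu operator and its weak form -/

/-- The operator `D = e₁ ∂₁ + e₂ ∂₂ + e₃ ∂₃` acting from the left on a differentiable function. -/
def dirac (φ : E3 → HC) (x : E3) : HC :=
  ∑ k : Fin 3, hmul (eUnit k.succ) (fderiv ℝ φ x (EuclideanSpace.single k 1))

/-- Test functions: the class `C₀^∞(G; ℍ_ℂ)`. -/
structure IsTest (G : Set E3) (φ : E3 → HC) : Prop where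
  smooth : ContDiff ℝ ∞ φ
  compact : HasCompactSupport φ
  support : tsupport φ ⊆ G

/-- `v` is a weak `D`-derivative of `u` in `G`. -/
structure IsWeakDirac (G : Set E3) (u v : E3 → HC) : Prop where
  left_loc : LocallyIntegrableOn u G volume
  right_loc : LocallyIntegrableOn v G volume
  integral_eq : ∀ φ : E3 → HC, IsTest G φ →
    ∫ t in G, hmul (hconj (u t)) (dirac φ t) = ∫ t in G, hmul (hconj (v t)) (φ t)

/-! ### The Vekua equation -/

/-- The operator `Q_A w = w a₁ + w̄ a₂ + a₃ w + a₄ w̄`, with `A = (a₁, a₂, a₃, a₄)` indexed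
by `0, 1, 2, 3`. -/
def vekuaQ (a : Fin 4 → E3 → HC) (w : E3 → HC) (x : E3) : HC :=
  hmul (w x) (a 0 x) + hmul (hconj (w x)) (a 1 x) + hmul (a 2 x) (w x) + hmul (a 3 x) (hconj (w x))

/-- The Hilbert space `L₂(G; ℍ_ℂ)`. -/
abbrev L2 (G : Set E3) : Type := Lp HC 2 (volume.restrict G)

/-- The space `L_∞(G; ℍ_ℂ)`. -/
abbrev LInf (G : Set E3) : Type := Lp HC ∞ (volume.restrict G)

/-- `w` is a weak solution of `D w - Q_A w = 0` in `G`. -/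
def IsWeakSolution (G : Set E3) (A : Fin 4 → LInf G) (w : E3 → HC) : Prop :=
  IsWeakDirac G w (vekuaQ (fun j => A j) w)

/-! #### Linearity and closedness of the space of weak solutions -/

/-- `Q_A` as a bounded operator on `L₂(G; ℍ_ℂ)`. -/
def vekuaQL {G : Set E3} (A : Fin 4 → LInf G) : L2 G →L[ℂ] L2 G :=
  hmulL.flip.holderL (volume.restrict G) ∞ 2 2 (A 0) +
  (hmulL.comp hconjL).flip.holderL (volume.restrict G) ∞ 2 2 (A 1) +
  hmulL.holderL (volume.restrict G) ∞ 2 2 (A 2) +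
  ((ContinuousLinearMap.compL ℂ HC HC HC).flip hconjL ∘L hmulL).holderL
    (volume.restrict G) ∞ 2 2 (A 3)

lemma coeFn_add_four {G : Set E3} (a b c d : L2 G) {a' b' c' d' : E3 → HC}
    (ha : a =ᵐ[volume.restrict G] a') (hb : b =ᵐ[volume.restrict G] b')
    (hc : c =ᵐ[volume.restrict G] c') (hd : d =ᵐ[volume.restrict G] d') :
    (a + b + c + d : L2 G) =ᵐ[volume.restrict G] a' + b' + c' + d' :=
  (Lp.coeFn_add _ _).trans (((Lp.coeFn_add _ _).trans
    (((Lp.coeFn_add _ _).trans (ha.add hb)).add hc)).add hd)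

lemma coeFn_vekuaQL {G : Set E3} (A : Fin 4 → LInf G) (w : L2 G) :
    vekuaQL A w =ᵐ[volume.restrict G] vekuaQ (fun j => A j) w :=
  coeFn_add_four _ _ _ _
    (hmulL.flip.coeFn_holder (A 0) w)
    ((hmulL.comp hconjL).flip.coeFn_holder (A 1) w)
    (hmulL.coeFn_holder (A 2) w)
    (((ContinuousLinearMap.compL ℂ HC HC HC).flip hconjL ∘L hmulL).coeFn_holder (A 3) w)

lemma locallyIntegrableOn_coe {G : Set E3} (w : L2 G) : LocallyIntegrableOn w G volume :=
  locallyIntegrableOn_of_locallyIntegrable_restrict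
    ((Lp.memLp w).locallyIntegrable (by norm_num))

lemma IsTest.memLp {G : Set E3} {φ : E3 → HC} (h : IsTest G φ) :
    MemLp φ 2 (volume.restrict G) :=
  (h.smooth.continuous.memLp_of_hasCompactSupport h.compact).restrict G

lemma IsTest.memLp_dirac {G : Set E3} {φ : E3 → HC} (h : IsTest G φ) :
    MemLp (dirac φ) 2 (volume.restrict G) := by
  refine MemLp.restrict G (Continuous.memLp_of_hasCompactSupport ?_ ?_)
  · unfold dirac
    refine continuous_finsetSum _ fun k _ => (hmulL (eUnit k.succ)).continuous.comp ?_
    exact (h.smooth.continuous_fderiv (by simp)).clm_apply continuous_const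
  · refine (h.compact.fderiv (𝕜 := ℝ)).mono' ?_
    refine (Function.support_subset_iff'.2 fun x hx => ?_).trans subset_closure
    have h0 : fderiv ℝ φ x = 0 := by simpa using hx
    simp only [dirac, h0, zero_apply]
    exact Finset.sum_eq_zero fun k _ => (hmulL (eUnit k.succ)).map_zero

/-- The functional expressing the weak equation against one test function. -/
def weakFunctional {G : Set E3} (A : Fin 4 → LInf G) (φ : {φ : E3 → HC // IsTest G φ}) :
    L2 G →L[ℂ] HC :=
  ((hmulL.comp hconjL).lpPairing (volume.restrict G) 2 2).flip (φ.2.memLp_dirac.toLp _) -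
  (((hmulL.comp hconjL).lpPairing (volume.restrict G) 2 2).flip (φ.2.memLp.toLp _)).comp (vekuaQL A)

lemma weakFunctional_apply {G : Set E3} (A : Fin 4 → LInf G) (φ : {φ : E3 → HC // IsTest G φ})
    (w : L2 G) : weakFunctional A φ w =
      (∫ t in G, hmul (hconj (w t)) (dirac φ.1 t)) -
      ∫ t in G, hmul (hconj (vekuaQ (fun j => A j) w t)) (φ.1 t) := by
  simp only [weakFunctional, sub_apply, ContinuousLinearMap.flip_apply,
    ContinuousLinearMap.comp_apply, ContinuousLinearMap.lpPairing_eq_integral, hmulL_apply,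
    hconjL_apply]
  congr 1
  · refine integral_congr_ae ?_
    filter_upwards [φ.2.memLp_dirac.coeFn_toLp] with t ht
    rw [ht]
  · refine integral_congr_ae ?_
    filter_upwards [φ.2.memLp.coeFn_toLp, coeFn_vekuaQL A w] with t ht hq
    rw [ht, hq]

lemma isWeakSolution_iff {G : Set E3} (A : Fin 4 → LInf G) (w : L2 G) :
    IsWeakSolution G A w ↔ ∀ φ, weakFunctional A φ w = 0 := by
  constructor
  · intro h φ
    rw [weakFunctional_apply, sub_eq_zero]
    exact h.integral_eq φ.1 φ.2
  · intro h
    refine ⟨locallyIntegrableOn_coe w, ?_, fun φ hφ => ?_⟩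
    · refine locallyIntegrableOn_of_locallyIntegrable_restrict
        (MemLp.locallyIntegrable (p := 2) ?_ (by norm_num))
      exact (memLp_congr_ae (coeFn_vekuaQL A w)).1 (Lp.memLp (vekuaQL A w))
    · have := h ⟨φ, hφ⟩
      rwa [weakFunctional_apply, sub_eq_zero] at this

/-- The Vekua-Bergman space for `p = 2`: all weak solutions `w ∈ L₂(G; ℍ_ℂ)` of
`D w - Q_A w = 0`, as a complex subspace of `L₂(G; ℍ_ℂ)`. -/
def vekuaSpace (G : Set E3) (A : Fin 4 → LInf G) : Submodule ℂ (L2 G) where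
  carrier := {w | IsWeakSolution G A w}
  add_mem' := by
    intro u v hu hv
    simp only [Set.mem_ofPred_eq, isWeakSolution_iff] at hu hv ⊢
    intro φ
    rw [map_add, hu, hv, add_zero]
  zero_mem' := by
    simp only [Set.mem_ofPred_eq, isWeakSolution_iff]
    intro φ
    exact map_zero _
  smul_mem' := by
    intro c u hu
    simp only [Set.mem_ofPred_eq, isWeakSolution_iff] at hu ⊢
    intro φ
    rw [map_smul, hu, smul_zero]

lemma isClosed_vekuaSpace (G : Set E3) (A : Fin 4 → LInf G) :
    IsClosed (vekuaSpace G A : Set (L2 G)) := by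
  have : (vekuaSpace G A : Set (L2 G)) = ⋂ φ, {w | weakFunctional A φ w = 0} := by
    ext w
    simp only [Set.mem_iInter, Set.mem_ofPred_eq]
    exact isWeakSolution_iff A w
  rw [this]
  exact isClosed_iInter fun φ => isClosed_eq (weakFunctional A φ).continuous continuous_const

instance completeSpace_vekuaSpace (G : Set E3) (A : Fin 4 → LInf G) :
    CompleteSpace (vekuaSpace G A) :=
  (isClosed_vekuaSpace G A).completeSpace_coe

/-- The Vekua-Bergman projection: the orthogonal projection of `L₂(G; ℍ_ℂ)` onto the
Vekua-Bergman space. -/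
def vekuaProj (G : Set E3) (A : Fin 4 → LInf G) : L2 G →L[ℂ] vekuaSpace G A :=
  (vekuaSpace G A).orthogonalProjectionOnto

/-! ### Point values, reproducing kernels -/

open scoped Classical in
/-- The continuous representative of a class in `L₂(G; ℍ_ℂ)` (the zero function if there is
none). For open `G` its values at the points of `G` are determined by the class. -/
def contRep {G : Set E3} (w : L2 G) : E3 → HC :=
  if h : ∃ f : E3 → HC, ContinuousOn f G ∧ f =ᵐ[volume.restrict G] w then h.choose else 0

open scoped Classical in
/-- The component kernel `K_x^k`: the element of the Vekua-Bergman space with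
`w_k(x) = ⟨K_x^k, w⟩` for all `w` in that space (zero if there is none). -/
def compKernel (G : Set E3) (A : Fin 4 → LInf G) (x : E3) (k : Fin 4) : vekuaSpace G A :=
  if h : ∃ K : vekuaSpace G A, ∀ w : vekuaSpace G A,
      contRep (w : L2 G) x k = inner ℂ (K : L2 G) (w : L2 G) then h.choose else 0

/-- The Vekua-Bergman kernel `𝒦(x, t; a) = ∑ⱼ K_t^j(x) a_j`. -/
def vekuaKernel (G : Set E3) (A : Fin 4 → LInf G) (x t : E3) (a : HC) : HC :=
  ∑ j : Fin 4, a j • contRep (compKernel G A t j : L2 G) x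

end VekuaBergman

end

open VekuaBergman

open MeasureTheory Filter Topology
open scoped ENNReal ContDiff

noncomputable section

namespace VekuaBergman

/-! ### Biquaternion algebra over the reals -/

/-! Everything rests on interior regularity: an `L₂` weak solution is continuous. The kernel `z /
|z|³` is, up to a constant, a fundamental solution of `D`. Its regularisation `regKernel ε` is
smooth, and `D` maps it to minus the approximate identity `regDelta ε`. For a cutoff `η`, testing
the weak equation with `η(t) regKernel ε (t - x)` is therefore legitimate and expresses a
mollification of `η w̄` as a regularised Cauchy transform of `cutoffDensity`
(`IsWeakDirac.integral_regDelta_eq`). Letting `ε → 0` gives `regMass • η w̄ = cauchyTransform` of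
that density almost everywhere (`ae_eq_cauchyTransform`).

The density is in `L_p` as soon as `w` is, because the coefficients of `Q_A` are bounded. The kernel
has size `|z|⁻²` in dimension three, so on a set of finite volume its transform maps `L₂` to `L₄`
(`memLp_four_cauchyTransform`) and `L₄` to continuous functions (`continuous_cauchyTransform`). Two
passes with nested cutoffs make `w` continuous near each point, and the local representatives glue.

The rest is Hilbert space theory. The value at `x` is the limit of averages over shrinking balls,
each a bounded functional, so Banach-Steinhaus makes evaluation bounded and Riesz representation
supplies the kernels `K_x^k`. Reproducing one kernel by another gives the symmetry `(K_t^j(x))_k =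
conj (K_x^k(t))_j`. It turns `(P u)_k(x) = ⟨K_x^k, P u⟩ = ⟨K_x^k, u⟩` into the integral of
`vekuaKernel`. -/

lemma hmul_add_right (p q r : HC) : hmul p (q + r) = hmul p q + hmul p r := by
  simp [← hmulL_apply]

lemma hmul_sub_left (p q r : HC) : hmul (p - q) r = hmul p r - hmul q r := by
  simp [← hmulL_apply]

lemma hmul_sub_right (p q r : HC) : hmul p (q - r) = hmul p q - hmul p r := by
  simp [← hmulL_apply]

lemma hmul_smul_right (c : ℝ) (p q : HC) : hmul p (c • q) = c • hmul p q :=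
  ((hmulL p).restrictScalars ℝ).map_smul c q

lemma hmul_smul_left (c : ℝ) (p q : HC) : hmul (c • p) q = c • hmul p q :=
  ((hmulL.flip q).restrictScalars ℝ).map_smul c p

lemma hconj_smul (c : ℝ) (p : HC) : hconj (c • p) = c • hconj p :=
  (hconjL.restrictScalars ℝ).map_smul c p

lemma hmul_assoc (p q r : HC) : hmul (hmul p q) r = hmul p (hmul q r) := by
  ext i
  fin_cases i <;> simp [hmul_eq] <;> ring

lemma hmul_eUnit_zero (p : HC) : hmul p (eUnit 0) = p := by
  ext i
  fin_cases i <;> simp [hmul_eq, eUnit]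

lemma hconj_hconj (p : HC) : hconj (hconj p) = p := by
  ext i
  fin_cases i <;> simp [hconj_eq]

/-- The norm of the product as a bilinear map. -/
def hmulNorm : NNReal := ‖hmulL‖₊

lemma norm_hmul_le (p q : HC) : ‖hmul p q‖ ≤ hmulNorm * ‖p‖ * ‖q‖ :=
  hmulL.le_opNorm₂ p q

/-- The embedding of three dimensional space as the real vectors `x₁ e₁ + x₂ e₂ + x₃ e₃`. -/
def vecPart : E3 →L[ℝ] HC :=
  ∑ k : Fin 3, (EuclideanSpace.proj k : E3 →L[ℝ] ℝ).smulRight (eUnit k.succ)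

lemma vecPart_apply (z : E3) : vecPart z = ∑ k : Fin 3, z k • eUnit k.succ := by
  simp [vecPart]

lemma vecPart_eq (z : E3) : vecPart z = !₂[0, (z 0 : ℂ), (z 1 : ℂ), (z 2 : ℂ)] := by
  rw [vecPart_apply]
  ext i
  fin_cases i <;> simp [Fin.sum_univ_succ, eUnit]

lemma norm_vecPart (z : E3) : ‖vecPart z‖ = ‖z‖ := by
  simp [EuclideanSpace.norm_eq, vecPart_eq, Fin.sum_univ_succ]

lemma hmul_vecPart_self (z : E3) : hmul (vecPart z) (vecPart z) = -(‖z‖ ^ 2) • eUnit 0 := by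
  rw [EuclideanSpace.real_norm_sq_eq, vecPart_eq]
  ext i
  fin_cases i <;> simp [hmul_eq, eUnit, Fin.sum_univ_succ] <;> ring

/-! ### The Dirac operator on elementary functions -/

/-- The gradient of a real function as a biquaternion. -/
def hgrad (g : E3 → ℝ) (x : E3) : HC :=
  ∑ k : Fin 3, fderiv ℝ g x (EuclideanSpace.single k 1) • eUnit k.succ

lemma continuous_hgrad {g : E3 → ℝ} (hg : ContDiff ℝ ∞ g) : Continuous (hgrad g) := by
  unfold hgrad
  refine continuous_finsetSum _ fun k _ => ?_
  have h := (hg.continuous_fderiv (by simp)).clm_apply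
    (continuous_const (y := EuclideanSpace.single k (1 : ℝ)))
  fun_prop

lemma hgrad_eq_zero {g : E3 → ℝ} {x : E3} (hx : x ∉ tsupport g) : hgrad g x = 0 := by
  have h : fderiv ℝ g x = 0 := by
    by_contra h
    exact hx (support_fderiv_subset ℝ (Function.mem_support.2 h))
  simp [hgrad, h]

/-- A real factor commutes with the units `e_k`, so the Leibniz rule holds with no reordering of
products. -/
lemma dirac_smul {g : E3 → ℝ} {φ : E3 → HC} {x : E3} (hg : DifferentiableAt ℝ g x)
    (hφ : DifferentiableAt ℝ φ x) :
    dirac (fun t => g t • φ t) x = hmul (hgrad g x) (φ x) + g x • dirac φ x := by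
  have h : fderiv ℝ (fun t => g t • φ t) x =
      g x • fderiv ℝ φ x + (fderiv ℝ g x).smulRight (φ x) := fderiv_smul hg hφ
  have h2 : hmul (hgrad g x) (φ x) =
      ∑ k : Fin 3, fderiv ℝ g x (EuclideanSpace.single k 1) • hmul (eUnit k.succ) (φ x) := by
    simp only [hgrad, ← hmul_smul_left]
    change hmulL.flip (φ x) _ = _
    rw [map_sum]
    rfl
  rw [h2]
  simp only [dirac, h, add_apply, smul_apply,
    ContinuousLinearMap.smulRight_apply, hmul_add_right, hmul_smul_right, Finset.sum_add_distrib,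
    Finset.smul_sum]
  rw [add_comm]

lemma dirac_vecPart_sub (x t : E3) :
    dirac (fun t => vecPart (t - x)) t = (-3 : ℝ) • eUnit 0 := by
  have h : fderiv ℝ (fun t => vecPart (t - x)) t = vecPart :=
    (vecPart.hasFDerivAt.comp t ((hasFDerivAt_id t).sub_const x)).fderiv
  simp only [dirac, h]
  simp only [vecPart_apply]
  ext i
  fin_cases i <;> simp [Fin.sum_univ_succ, eUnit, hmul_eq]
  norm_num

/-- The regularised Cauchy kernel `(ε² + |z|²)^(-3/2) z`; for `ε = 0` it is the Cauchy kernel of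
the Dirac operator, up to a constant factor. -/
def regKernel (ε : ℝ) (z : E3) : HC := (ε ^ 2 + ‖z‖ ^ 2) ^ (-(3 / 2) : ℝ) • vecPart z

/-- The Dirac derivative of the regularised Cauchy kernel, up to sign. -/
def regDelta (ε : ℝ) (z : E3) : ℝ := 3 * ε ^ 2 * (ε ^ 2 + ‖z‖ ^ 2) ^ (-(5 / 2) : ℝ)

lemma contDiff_rpow_norm_sq {ε : ℝ} (hε : ε ≠ 0) (p : ℝ) (x : E3) :
    ContDiff ℝ ∞ fun t : E3 => (ε ^ 2 + ‖t - x‖ ^ 2) ^ p := by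
  refine ContDiff.rpow_const_of_ne ?_ fun t => by positivity
  exact contDiff_const.add ((contDiff_id.sub contDiff_const).norm_sq ℝ)

lemma hgrad_rpow_norm_sq {ε : ℝ} (hε : ε ≠ 0) (p : ℝ) (x t : E3) :
    hgrad (fun t : E3 => (ε ^ 2 + ‖t - x‖ ^ 2) ^ p) t =
      (2 * p * (ε ^ 2 + ‖t - x‖ ^ 2) ^ (p - 1)) • vecPart (t - x) := by
  have h1 : HasFDerivAt (fun t : E3 => ε ^ 2 + ‖t - x‖ ^ 2)
      (2 • (innerSL ℝ (t - x)).comp (ContinuousLinearMap.id ℝ E3)) t :=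
    (((hasFDerivAt_id t).sub_const x).norm_sq).const_add _
  have h2 := (h1.rpow_const (p := p) (Or.inl (by positivity))).fderiv
  simp only [hgrad, h2, vecPart_apply, Finset.smul_sum, smul_smul]
  refine Finset.sum_congr rfl fun k _ => ?_
  congr 1
  have hi : inner ℝ (t - x) (EuclideanSpace.single k 1) = (t - x) k := by
    simp [EuclideanSpace.inner_single_right]
  simp only [smul_apply, ContinuousLinearMap.comp_apply,
    ContinuousLinearMap.id_apply, innerSL_apply_apply, hi, smul_eq_mul, nsmul_eq_mul]
  push_cast
  ring

lemma contDiff_regKernel {ε : ℝ} (hε : ε ≠ 0) (x : E3) :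
    ContDiff ℝ ∞ fun t : E3 => regKernel ε (t - x) :=
  (contDiff_rpow_norm_sq hε _ x).smul (vecPart.contDiff.comp (contDiff_id.sub contDiff_const))

/-- With `ρ = ε² + |z|²`, the gradient term contributes `3 |z|² ρ^(-5/2)` because `z z = -|z|²`, and
`D z = -3` contributes `-3 ρ^(-3/2) = -3 (ε² + |z|²) ρ^(-5/2)`. Only `-3 ε² ρ^(-5/2)` survives. -/
lemma dirac_regKernel {ε : ℝ} (hε : ε ≠ 0) (x t : E3) :
    dirac (fun t => regKernel ε (t - x)) t = -(regDelta ε (t - x) • eUnit 0) := by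
  have h0 : 0 < ε ^ 2 + ‖t - x‖ ^ 2 := by positivity
  unfold regKernel
  rw [dirac_smul (φ := fun t => vecPart (t - x))
    ((contDiff_rpow_norm_sq hε _ x).differentiable (by simp) t)
    ((vecPart.differentiable.comp (differentiable_id.sub_const x)) t),
    hgrad_rpow_norm_sq hε, dirac_vecPart_sub, hmul_smul_left, hmul_vecPart_self, smul_smul,
    smul_smul, ← add_smul, ← neg_smul]
  congr 1
  have h3 : (ε ^ 2 + ‖t - x‖ ^ 2) ^ (-(3 / 2) : ℝ) =
      (ε ^ 2 + ‖t - x‖ ^ 2) ^ (-(5 / 2) : ℝ) * (ε ^ 2 + ‖t - x‖ ^ 2) := by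
    rw [← Real.rpow_add_one h0.ne']
    norm_num
  have h4 : (-(3 / 2) - 1 : ℝ) = -(5 / 2) := by norm_num
  rw [h3, h4, regDelta]
  ring

lemma regDelta_nonneg (ε : ℝ) (z : E3) : 0 ≤ regDelta ε z := by
  unfold regDelta; positivity

/-- The majorant is independent of `ε` and serves every dominated limit `ε → 0`. At the origin both
sides vanish, since `0 ^ (-2 : ℝ) = 0`. -/
lemma norm_regKernel_le (ε : ℝ) (z : E3) : ‖regKernel ε z‖ ≤ ‖z‖ ^ (-2 : ℝ) := by
  rcases eq_or_ne z 0 with rfl | hz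
  · simp [regKernel]
  have hz' : 0 < ‖z‖ := norm_pos_iff.2 hz
  rw [regKernel, norm_smul, norm_vecPart, Real.norm_of_nonneg (by positivity)]
  have h1 : (ε ^ 2 + ‖z‖ ^ 2) ^ (-(3 / 2) : ℝ) ≤ (‖z‖ ^ 2) ^ (-(3 / 2) : ℝ) :=
    Real.rpow_le_rpow_of_nonpos (by positivity) (by nlinarith [sq_nonneg ε]) (by norm_num)
  refine (mul_le_mul_of_nonneg_right h1 hz'.le).trans_eq ?_
  rw [← Real.rpow_natCast, ← Real.rpow_mul hz'.le, ← Real.rpow_add_one hz'.ne']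
  norm_num

lemma continuous_regDelta {ε : ℝ} (hε : ε ≠ 0) : Continuous (regDelta ε) := by
  have := (contDiff_rpow_norm_sq hε (-(5 / 2)) 0).continuous
  simp only [sub_zero] at this
  exact continuous_const.mul this

lemma measurable_regKernel (ε : ℝ) : Measurable (regKernel ε) := by
  unfold regKernel
  fun_prop

lemma tendsto_regKernel (z : E3) : Tendsto (fun ε => regKernel ε z) (𝓝 0) (𝓝 (regKernel 0 z)) := by
  rcases eq_or_ne z 0 with rfl | hz
  · simp [regKernel]
  have hz' : 0 < ‖z‖ := norm_pos_iff.2 hz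
  refine ContinuousAt.tendsto ?_
  unfold regKernel
  refine ContinuousAt.smul (ContinuousAt.rpow_const (by fun_prop) (Or.inl ?_)) continuousAt_const
  positivity

lemma norm_regKernel_le_const (ε : ℝ) (hε : 0 < ε) (z : E3) : ‖regKernel ε z‖ ≤ ε ^ (-2 : ℝ) := by
  have h0 : 0 < ε ^ 2 + ‖z‖ ^ 2 := by positivity
  rw [regKernel, norm_smul, norm_vecPart, Real.norm_of_nonneg (by positivity)]
  have h2 : ‖z‖ ≤ (ε ^ 2 + ‖z‖ ^ 2) ^ (1 / 2 : ℝ) := by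
    rw [← Real.sqrt_eq_rpow]
    exact Real.le_sqrt_of_sq_le (by nlinarith [sq_nonneg ε])
  refine (mul_le_mul_of_nonneg_left h2 (by positivity)).trans ?_
  rw [← Real.rpow_add h0]
  have h1 : (ε ^ 2 + ‖z‖ ^ 2) ^ (-(3 / 2) + 1 / 2 : ℝ) ≤ (ε ^ 2) ^ (-(3 / 2) + 1 / 2 : ℝ) :=
    Real.rpow_le_rpow_of_nonpos (by positivity) (by nlinarith [sq_nonneg ‖z‖]) (by norm_num)
  refine h1.trans_eq ?_
  rw [← Real.rpow_natCast, ← Real.rpow_mul hε.le]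
  norm_num

lemma regDelta_le_const {ε : ℝ} (hε : 0 < ε) (z : E3) :
    regDelta ε z ≤ 3 * ε ^ 2 * (ε ^ 2) ^ (-(5 / 2) : ℝ) := by
  refine mul_le_mul_of_nonneg_left ?_ (by positivity)
  exact Real.rpow_le_rpow_of_nonpos (by positivity) (by nlinarith [sq_nonneg ‖z‖]) (by norm_num)

/-! ### Estimates for Riesz kernels -/

/-- The Riesz kernel `|z|^(-s)` with values in `[0, ∞]` (and the value `0` at the origin if
`s ≠ 0`). -/
def rieszKernel (s : ℝ) (z : E3) : ℝ≥0∞ := ENNReal.ofReal (‖z‖ ^ (-s))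

lemma measurable_rieszKernel (s : ℝ) : Measurable (rieszKernel s) := by
  unfold rieszKernel
  fun_prop

lemma rieszKernel_pow (s : ℝ) (n : ℕ) (z : E3) :
    rieszKernel s z ^ n = rieszKernel (s * n) z := by
  rw [rieszKernel, rieszKernel, ← ENNReal.ofReal_pow (by positivity), ← Real.rpow_natCast,
    ← Real.rpow_mul (norm_nonneg z), neg_mul]

lemma rieszKernel_sub_comm (s : ℝ) (x y : E3) : rieszKernel s (x - y) = rieszKernel s (y - x) := by
  rw [rieszKernel, rieszKernel, norm_sub_rev]

/-- In polar coordinates the integrand is `r^(2 - s)`, integrable at `0` exactly when `s < 3`. -/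
lemma setLIntegral_rieszKernel_ball_lt_top {s : ℝ} (hs : s < 3) :
    ∫⁻ z in Metric.ball 0 1, rieszKernel s z < ⊤ := by
  have h : IntegrableOn (fun z : E3 => ‖z‖ ^ (-s)) (Metric.ball 0 1) := by
    rw [integrableOn_fun_norm_addHaar volume (f := fun y : ℝ => y ^ (-s))]
    have h2 : IntegrableOn (fun y : ℝ => y ^ (2 - s)) (Set.Ioo 0 1) :=
      (intervalIntegral.integrableOn_Ioo_rpow_iff one_pos).2 (by linarith)
    refine h2.congr_fun (fun y hy => ?_) measurableSet_Ioo
    have hy0 : 0 < y := hy.1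
    simp only [finrank_euclideanSpace, Fintype.card_fin, smul_eq_mul]
    rw [← Real.rpow_natCast, ← Real.rpow_add hy0]
    norm_num
    rfl
  have h3 := h.2
  rw [HasFiniteIntegral] at h3
  refine lt_of_eq_of_lt (lintegral_congr fun z => ?_) h3
  rw [rieszKernel, Real.enorm_of_nonneg (by positivity)]

/-- Near the singularity translation invariance removes `x`; at distance at least one the kernel is
at most `1` and costs no more than `volume G`. -/
lemma exists_setLIntegral_rieszKernel_le {G : Set E3} (hG : volume G ≠ ⊤) {s : ℝ} (hs0 : 0 < s)
    (hs : s < 3) :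
    ∃ C : ℝ≥0∞, C ≠ ⊤ ∧ ∀ x, ∫⁻ t in G, rieszKernel s (t - x) ≤ C := by
  refine ⟨(∫⁻ z in Metric.ball 0 1, rieszKernel s z) + volume G,
    (ENNReal.add_lt_top.2 ⟨setLIntegral_rieszKernel_ball_lt_top hs, hG.lt_top⟩).ne, fun x => ?_⟩
  have h1 : ∀ z, rieszKernel s z ≤ (Metric.ball 0 1).indicator (rieszKernel s) z + 1 := by
    intro z
    by_cases hz : z ∈ Metric.ball (0 : E3) 1
    · simp [hz]
    · have hz1 : 1 ≤ ‖z‖ := by simpa using hz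
      simp only [hz, not_false_eq_true, Set.indicator_of_notMem, zero_add, rieszKernel]
      exact ENNReal.ofReal_le_one.2 (Real.rpow_le_one_of_one_le_of_nonpos hz1 (by linarith))
  calc ∫⁻ t in G, rieszKernel s (t - x)
      ≤ ∫⁻ t in G, ((Metric.ball 0 1).indicator (rieszKernel s) (t - x) + 1) :=
        lintegral_mono fun t => h1 _
    _ = (∫⁻ t in G, (Metric.ball 0 1).indicator (rieszKernel s) (t - x)) + volume G := by
        rw [lintegral_add_right _ measurable_const]
        simp
    _ ≤ (∫⁻ t, (Metric.ball 0 1).indicator (rieszKernel s) (t - x)) + volume G := by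
        gcongr
        exact Measure.restrict_le_self
    _ = _ := by
        rw [lintegral_sub_right_eq_self (fun t => (Metric.ball 0 1).indicator (rieszKernel s) t) x,
          lintegral_indicator measurableSet_ball]

/-! ### Hölder-type inequalities obtained by iterating Cauchy-Schwarz -/

section

variable {α : Type*} [MeasurableSpace α] {μ : Measure α}

lemma lintegral_mul_sq_le {f g : α → ℝ≥0∞} (hf : AEMeasurable f μ) (hg : AEMeasurable g μ) :
    (∫⁻ a, f a * g a ∂μ) ^ 2 ≤ (∫⁻ a, f a ^ 2 ∂μ) * ∫⁻ a, g a ^ 2 ∂μ := by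
  have h := ENNReal.lintegral_mul_le_Lp_mul_Lq μ Real.HolderConjugate.two_two hf hg
  simp only [Pi.mul_apply, ENNReal.rpow_two] at h
  refine (pow_le_pow_left' h 2).trans_eq ?_
  rw [mul_pow, ← ENNReal.rpow_two, ← ENNReal.rpow_two, ← ENNReal.rpow_mul, ← ENNReal.rpow_mul]
  norm_num

/-- Cauchy-Schwarz is applied to `(h k) · k²` and then to `h · (h k²)`. With `k³` the Riesz kernel,
only square integrability of `h` is needed, and the factor `∫ h² k⁴` can be integrated in the base
point by Tonelli. -/
lemma lintegral_mul_cube_pow_four_le_of_sq {h k : α → ℝ≥0∞} (hh : AEMeasurable h μ)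
    (hk : AEMeasurable k μ) :
    (∫⁻ a, h a * k a ^ 3 ∂μ) ^ 4 ≤
      (∫⁻ a, h a ^ 2 ∂μ) * (∫⁻ a, h a ^ 2 * k a ^ 4 ∂μ) * (∫⁻ a, k a ^ 4 ∂μ) ^ 2 := by
  have h1 := lintegral_mul_sq_le (f := fun a => h a * k a) (g := fun a => k a ^ 2) (hh.mul hk)
    (hk.pow_const 2)
  have h2 := lintegral_mul_sq_le (f := h) (g := fun a => h a * k a ^ 2) hh
    (hh.mul (hk.pow_const 2))
  calc (∫⁻ a, h a * k a ^ 3 ∂μ) ^ 4 = ((∫⁻ a, h a * k a * k a ^ 2 ∂μ) ^ 2) ^ 2 := by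
        rw [← pow_mul]
        congr 2 with a
        ring
    _ ≤ ((∫⁻ a, (h a * k a) ^ 2 ∂μ) * ∫⁻ a, (k a ^ 2) ^ 2 ∂μ) ^ 2 := pow_le_pow_left' h1 2
    _ = (∫⁻ a, h a * (h a * k a ^ 2) ∂μ) ^ 2 * (∫⁻ a, k a ^ 4 ∂μ) ^ 2 := by
        rw [mul_pow]
        congr 3 <;> ext a <;> ring
    _ ≤ ((∫⁻ a, h a ^ 2 ∂μ) * ∫⁻ a, (h a * k a ^ 2) ^ 2 ∂μ) * (∫⁻ a, k a ^ 4 ∂μ) ^ 2 := by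
        gcongr
    _ = _ := by
        congr 3 with a
        ring

/-- Hölder with exponents `4` and `4/3`, by splitting as `(h k) · k²` and then `h² · k²`. -/
lemma lintegral_mul_cube_pow_four_le {h k : α → ℝ≥0∞} (hh : AEMeasurable h μ)
    (hk : AEMeasurable k μ) :
    (∫⁻ a, h a * k a ^ 3 ∂μ) ^ 4 ≤ (∫⁻ a, h a ^ 4 ∂μ) * (∫⁻ a, k a ^ 4 ∂μ) ^ 3 := by
  have h1 := lintegral_mul_sq_le (f := fun a => h a * k a) (g := fun a => k a ^ 2) (hh.mul hk)
    (hk.pow_const 2)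
  have h2 := lintegral_mul_sq_le (f := fun a => h a ^ 2) (g := fun a => k a ^ 2) (hh.pow_const 2)
    (hk.pow_const 2)
  calc (∫⁻ a, h a * k a ^ 3 ∂μ) ^ 4 = ((∫⁻ a, h a * k a * k a ^ 2 ∂μ) ^ 2) ^ 2 := by
        rw [← pow_mul]
        congr 2 with a
        ring
    _ ≤ ((∫⁻ a, (h a * k a) ^ 2 ∂μ) * ∫⁻ a, (k a ^ 2) ^ 2 ∂μ) ^ 2 := pow_le_pow_left' h1 2
    _ = (∫⁻ a, h a ^ 2 * k a ^ 2 ∂μ) ^ 2 * (∫⁻ a, k a ^ 4 ∂μ) ^ 2 := by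
        rw [mul_pow]
        congr 3 <;> ext a <;> ring
    _ ≤ ((∫⁻ a, (h a ^ 2) ^ 2 ∂μ) * ∫⁻ a, (k a ^ 2) ^ 2 ∂μ) * (∫⁻ a, k a ^ 4 ∂μ) ^ 2 := by
        gcongr
    _ = _ := by
        rw [mul_assoc, pow_succ' _ 2]
        congr 2
        · ext a; ring
        · congr 2 with a
          ring

end

/-- The Riesz potential of order one maps `L₂` to `L₄` on a set of finite volume. -/
lemma lintegral_rieszPotential_pow_four_lt_top {G : Set E3} (hG : volume G ≠ ⊤) {h : E3 → ℝ≥0∞}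
    (hh : AEMeasurable h (volume.restrict G)) (h2 : ∫⁻ t in G, h t ^ 2 ≠ ⊤) :
    ∫⁻ x in G, (∫⁻ t in G, h t * rieszKernel 2 (t - x)) ^ 4 < ⊤ := by
  -- With `k = |z|^(-2/3)`, the kernel of order `2` is `k³`, while `k⁴` has order `8/3 < 3` and is
  -- still integrable.
  obtain ⟨C, hC, hC'⟩ := exists_setLIntegral_rieszKernel_le hG (s := 8 / 3) (by norm_num)
    (by norm_num)
  have e3 : ∀ z, rieszKernel 2 z = rieszKernel (2 / 3) z ^ 3 := fun z => by
    rw [rieszKernel_pow]; norm_num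
  have e4 : ∀ z, rieszKernel (2 / 3) z ^ 4 = rieszKernel (8 / 3) z := fun z => by
    rw [rieszKernel_pow]; norm_num
  have hm : ∀ x, AEMeasurable (fun t => rieszKernel (2 / 3) (t - x)) (volume.restrict G) :=
    fun x => ((measurable_rieszKernel _).comp (measurable_id.sub_const x)).aemeasurable
  have hsw : ∫⁻ x in G, ∫⁻ t in G, h t ^ 2 * rieszKernel (8 / 3) (t - x) ≤
      (∫⁻ t in G, h t ^ 2) * C := by
    rw [lintegral_lintegral_swap]
    · rw [← lintegral_mul_const'' _ (hh.pow_const 2)]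
      refine lintegral_mono fun t => ?_
      rw [lintegral_const_mul]
      · gcongr
        simp_rw [rieszKernel_sub_comm _ t]
        exact hC' t
      · exact (measurable_rieszKernel _).comp (measurable_const.sub measurable_id)
    · refine AEMeasurable.mul ((hh.pow_const 2).comp_quasiMeasurePreserving
        Measure.quasiMeasurePreserving_snd) ?_
      exact ((measurable_rieszKernel _).comp
        (measurable_snd.sub measurable_fst)).aemeasurable
  calc ∫⁻ x in G, (∫⁻ t in G, h t * rieszKernel 2 (t - x)) ^ 4
      ≤ ∫⁻ x in G, (∫⁻ t in G, h t ^ 2) * C ^ 2 *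
          ∫⁻ t in G, h t ^ 2 * rieszKernel (8 / 3) (t - x) := by
        refine lintegral_mono fun x => ?_
        simp only [e3]
        refine (lintegral_mul_cube_pow_four_le_of_sq hh (hm x)).trans ?_
        simp only [e4]
        rw [mul_right_comm]
        gcongr
        exact hC' x
    _ = (∫⁻ t in G, h t ^ 2) * C ^ 2 *
          ∫⁻ x in G, ∫⁻ t in G, h t ^ 2 * rieszKernel (8 / 3) (t - x) :=
        lintegral_const_mul' _ _ (ENNReal.mul_ne_top h2 (ENNReal.pow_ne_top hC))
    _ ≤ (∫⁻ t in G, h t ^ 2) * C ^ 2 * ((∫⁻ t in G, h t ^ 2) * C) := by gcongr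
    _ < ⊤ := by
        refine ENNReal.mul_lt_top (ENNReal.mul_lt_top h2.lt_top (ENNReal.pow_lt_top hC.lt_top)) ?_
        exact ENNReal.mul_lt_top h2.lt_top hC.lt_top

/-- Hölder puts the kernel in `L_(4/3)`, where it has order `4 s / 3`; this is below the critical
`3` exactly when `s < 9/4`. The admissible range goes past `2`, which leaves room for a continuity
estimate. -/
lemma exists_rieszPotential_le {G : Set E3} (hG : volume G ≠ ⊤) {h : E3 → ℝ≥0∞}
    (hh : AEMeasurable h (volume.restrict G)) (h4 : ∫⁻ t in G, h t ^ 4 ≠ ⊤) {s : ℝ} (hs0 : 0 < s)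
    (hs : s < 9 / 4) :
    ∃ C : ℝ≥0∞, C ≠ ⊤ ∧ ∀ x, ∫⁻ t in G, h t * rieszKernel s (t - x) ≤ C := by
  obtain ⟨C, hC, hC'⟩ := exists_setLIntegral_rieszKernel_le hG (s := s / 3 * (4 : ℕ))
    (by positivity) (by push_cast; linarith)
  refine ⟨((∫⁻ t in G, h t ^ 4) * C ^ 3) ^ ((4 : ℝ)⁻¹),
    (ENNReal.rpow_lt_top_of_nonneg (by norm_num)
      (ENNReal.mul_ne_top h4 (ENNReal.pow_ne_top hC))).ne, fun x => ?_⟩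
  have hm : AEMeasurable (fun t => rieszKernel (s / 3) (t - x)) (volume.restrict G) :=
    ((measurable_rieszKernel _).comp (measurable_id.sub_const x)).aemeasurable
  have h1 := lintegral_mul_cube_pow_four_le hh hm
  simp only [rieszKernel_pow] at h1
  rw [show s / 3 * (3 : ℕ) = s by push_cast; ring] at h1
  rw [ENNReal.le_rpow_inv_iff (by norm_num)]
  refine le_trans (le_of_eq ?_) (h1.trans ?_)
  · norm_cast
  · gcongr
    exact hC' x

/-! ### The Cauchy kernel as a fundamental solution -/

/-- The total mass of the approximate identity `regDelta`. -/
def regMass : ℝ := ∫ z : E3, regDelta 1 z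

lemma integrable_regDelta_one : Integrable (regDelta 1) (volume : Measure E3) := by
  have h : Integrable (fun x : E3 => ((1 : ℝ) + ‖x‖ ^ 2) ^ (-(5 : ℝ) / 2)) volume :=
    integrable_rpow_neg_one_add_norm_sq (by simp; norm_num)
  refine (h.const_mul 3).congr (Eventually.of_forall fun z => ?_)
  simp only [regDelta]
  norm_num

lemma regMass_pos : 0 < regMass := by
  refine integral_pos_of_integrable_nonneg_nonzero (x := 0) (continuous_regDelta one_ne_zero)
    integrable_regDelta_one (fun z => regDelta_nonneg 1 z) ?_
  simp [regDelta]

/-- With `ε = c⁻¹`, the family is the standard mass-preserving dilation of one profile in dimension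
three. -/
lemma regDelta_inv {c : ℝ} (hc : 0 < c) (z : E3) :
    regDelta c⁻¹ z = c ^ 3 * regDelta 1 (c • z) := by
  have h1 : (1 : ℝ) ^ 2 + ‖c • z‖ ^ 2 = c ^ 2 * ((c⁻¹) ^ 2 + ‖z‖ ^ 2) := by
    rw [norm_smul, Real.norm_of_nonneg hc.le]
    field_simp
  have h2 : (c ^ 2) ^ (-(5 / 2) : ℝ) = (c ^ 5)⁻¹ := by
    rw [← Real.rpow_natCast, ← Real.rpow_mul hc.le, ← Real.rpow_natCast, ← Real.rpow_neg hc.le]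
    norm_num
  rw [regDelta, regDelta, h1, Real.mul_rpow (by positivity) (by positivity), h2]
  field_simp

lemma integral_regDelta_sub {c : ℝ} (hc : 0 < c) (t : E3) :
    ∫ x, regDelta c⁻¹ (t - x) = regMass := by
  rw [integral_sub_left_eq_self (fun x => regDelta c⁻¹ x)]
  simp only [regDelta_inv hc]
  rw [integral_const_mul, Measure.integral_comp_smul]
  simp only [finrank_euclideanSpace, Fintype.card_fin, smul_eq_mul, regMass]
  rw [abs_of_pos (by positivity)]
  field_simp

lemma integrable_regDelta_sub {c : ℝ} (hc : 0 < c) (t : E3) :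
    Integrable (fun x => regDelta c⁻¹ (t - x)) volume := by
  -- The Bochner integral of a non-integrable function is `0` by convention, so a nonzero value
  -- forces integrability.
  refine Integrable.of_integral_ne_zero ?_
  rw [integral_regDelta_sub hc]
  exact regMass_pos.ne'

/-- The profile decays like `|x|⁻⁵`, more than the `o(|x|⁻³)` that the peak function theorem asks
for. -/
lemma tendsto_norm_pow_mul_regDelta :
    Tendsto (fun x : E3 => ‖x‖ ^ 3 * regDelta 1 x) (Bornology.cobounded E3) (𝓝 0) := by
  have h1 : Tendsto (fun x : E3 => 3 * ‖x‖⁻¹) (Bornology.cobounded E3) (𝓝 0) := by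
    simpa using (tendsto_inv_atTop_zero.comp tendsto_norm_cobounded_atTop).const_mul (3 : ℝ)
  refine squeeze_zero' (Eventually.of_forall fun x => mul_nonneg (by positivity)
    (regDelta_nonneg 1 x)) ?_ h1
  filter_upwards [tendsto_norm_cobounded_atTop.eventually (eventually_ge_atTop 1)] with x hx
  have hx0 : 0 < ‖x‖ := by linarith
  have h2 : ((1 : ℝ) ^ 2 + ‖x‖ ^ 2) ^ (-(5 / 2) : ℝ) ≤ (‖x‖ ^ 2) ^ (-(5 / 2) : ℝ) :=
    Real.rpow_le_rpow_of_nonpos (by positivity) (by linarith) (by norm_num)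
  have h3 : (‖x‖ ^ 2) ^ (-(5 / 2) : ℝ) = (‖x‖ ^ 5)⁻¹ := by
    rw [← Real.rpow_natCast, ← Real.rpow_mul hx0.le, ← Real.rpow_natCast, ← Real.rpow_neg hx0.le]
    norm_num
  rw [h3] at h2
  calc ‖x‖ ^ 3 * regDelta 1 x ≤ ‖x‖ ^ 3 * (3 * 1 ^ 2 * (‖x‖ ^ 5)⁻¹) := by
        unfold regDelta
        gcongr
    _ = 3 * ‖x‖⁻¹ * ‖x‖⁻¹ := by field_simp
    _ ≤ 3 * ‖x‖⁻¹ * 1 := by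
        gcongr
        exact inv_le_one_of_one_le₀ hx
    _ = 3 * ‖x‖⁻¹ := mul_one _

lemma tendsto_integral_regDelta {ψ : E3 → ℝ} (hψ : Continuous ψ) (hc : HasCompactSupport ψ)
    (t : E3) :
    Tendsto (fun c : ℝ => ∫ x, ψ x * regDelta c⁻¹ (t - x)) atTop (𝓝 (ψ t * regMass)) := by
  have hm := regMass_pos
  have h := tendsto_integral_comp_smul_smul_of_integrable' (μ := (volume : Measure E3))
    (φ := fun z => regMass⁻¹ * regDelta 1 z) (g := ψ) (x₀ := t)
    (fun z => mul_nonneg (by positivity) (regDelta_nonneg 1 z))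
    (by rw [integral_const_mul]; exact inv_mul_cancel₀ hm.ne')
    (by
      have := tendsto_norm_pow_mul_regDelta.const_mul regMass⁻¹
      simp only [mul_zero] at this
      refine this.congr fun z => ?_
      simp only [finrank_euclideanSpace, Fintype.card_fin]
      ring)
    (hψ.integrable_of_hasCompactSupport hc) hψ.continuousAt
  refine (h.mul_const regMass).congr' ?_
  filter_upwards [eventually_gt_atTop 0] with c hc0
  rw [← integral_mul_const]
  refine integral_congr_ae (Eventually.of_forall fun x => ?_)
  simp only [finrank_euclideanSpace, Fintype.card_fin, smul_eq_mul, regDelta_inv hc0]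
  field_simp

/-- By Tonelli, integrating in the base point first leaves a uniformly bounded integral, as `2 < 3`.
This is the common majorant for Fubini and for the limits in `ε`. -/
lemma integrable_norm_mul_rpow_prod {G : Set E3} (hG : volume G ≠ ⊤) {H : E3 → HC}
    (hH : Integrable H (volume.restrict G)) :
    Integrable (fun p : E3 × E3 => ‖H p.2‖ * ‖p.2 - p.1‖ ^ (-2 : ℝ))
      ((volume.restrict G).prod (volume.restrict G)) := by
  obtain ⟨C, hC, hC'⟩ := exists_setLIntegral_rieszKernel_le hG (s := 2) (by norm_num)
    (by norm_num)
  have hm : AEStronglyMeasurable (fun p : E3 × E3 => ‖H p.2‖ * ‖p.2 - p.1‖ ^ (-2 : ℝ))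
      ((volume.restrict G).prod (volume.restrict G)) := by
    refine (hH.1.comp_snd).norm.mul (Measurable.aestronglyMeasurable ?_)
    fun_prop
  refine ⟨hm, ?_⟩
  rw [HasFiniteIntegral, lintegral_prod_symm _ hm.enorm]
  refine lt_of_le_of_lt (b := (∫⁻ t in G, ‖H t‖ₑ * C)) (lintegral_mono fun t => ?_) ?_
  · simp only [enorm_mul, enorm_norm]
    rw [lintegral_const_mul' _ _ enorm_ne_top]
    gcongr
    refine le_trans (le_of_eq (lintegral_congr fun x => ?_)) (hC' t)
    rw [rieszKernel_sub_comm, rieszKernel, Real.enorm_of_nonneg (by positivity)]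
  · rw [lintegral_mul_const' _ _ hC]
    exact ENNReal.mul_lt_top hH.2 hC.lt_top

lemma norm_hmul_regKernel_le (H : E3 → HC) (ε : ℝ) (x t : E3) :
    ‖hmul (H t) (regKernel ε (t - x))‖ ≤ hmulNorm * (‖H t‖ * ‖t - x‖ ^ (-2 : ℝ)) := by
  refine (norm_hmul_le _ _).trans ?_
  rw [mul_assoc]
  gcongr
  exact norm_regKernel_le _ _

lemma aestronglyMeasurable_hmul_regKernel {μ : Measure E3} {H : E3 → HC}
    (hH : AEStronglyMeasurable H μ) (ε : ℝ) (x : E3) :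
    AEStronglyMeasurable (fun t => hmul (H t) (regKernel ε (t - x))) μ :=
  hmulL.aestronglyMeasurable_comp₂ hH
    ((measurable_regKernel ε).comp (measurable_id.sub_const x)).aestronglyMeasurable

/-- The Cauchy transform (Teodorescu transform) of `H` over `G`, up to a constant factor. -/
def cauchyTransform (G : Set E3) (H : E3 → HC) (x : E3) : HC :=
  ∫ t in G, hmul (H t) (regKernel 0 (t - x))

lemma integrable_cauchyTransform {G : Set E3} (hG : volume G ≠ ⊤) {H : E3 → HC}
    (hH : Integrable H (volume.restrict G)) :
    Integrable (cauchyTransform G H) (volume.restrict G) := by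
  have h : Integrable (fun p : E3 × E3 => hmul (H p.2) (regKernel 0 (p.2 - p.1)))
      ((volume.restrict G).prod (volume.restrict G)) := by
    refine ((integrable_norm_mul_rpow_prod hG hH).const_mul hmulNorm).mono' ?_
      (Eventually.of_forall fun p => norm_hmul_regKernel_le H 0 p.1 p.2)
    exact hmulL.aestronglyMeasurable_comp₂ hH.1.comp_snd
      ((measurable_regKernel 0).comp
        (measurable_snd.sub measurable_fst)).aestronglyMeasurable
  exact h.integral_prod_left

/-- Dominated convergence is used twice, in the inner variable for almost every `x` and then in `x`,
both times with the majorant on the product. -/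
lemma tendsto_integral_regKernel {G : Set E3} (hG : volume G ≠ ⊤) {H : E3 → HC}
    (hH : Integrable H (volume.restrict G)) {ψ : E3 → ℝ} (hψ : Continuous ψ)
    (hψc : HasCompactSupport ψ) :
    Tendsto (fun c : ℝ => ∫ x in G, ψ x • ∫ t in G, hmul (H t) (regKernel c⁻¹ (t - x))) atTop
      (𝓝 (∫ x in G, ψ x • cauchyTransform G H x)) := by
  have hp := integrable_norm_mul_rpow_prod hG hH
  obtain ⟨M, hM⟩ := hψ.bounded_above_of_compact_support hψc
  have hb := (hp.integral_prod_left.const_mul (M * (hmulNorm : ℝ)))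
  have : IsFiniteMeasure (volume.restrict G) := ⟨by simpa using hG.lt_top⟩
  refine tendsto_integral_filter_of_dominated_convergence _ ?_ ?_ hb ?_
  · filter_upwards [eventually_gt_atTop 0] with c hc
    refine hψ.aestronglyMeasurable.smul ?_
    refine AEStronglyMeasurable.integral_prod_right' (f := fun p : E3 × E3 =>
      hmul (H p.2) (regKernel c⁻¹ (p.2 - p.1))) ?_
    exact hmulL.aestronglyMeasurable_comp₂ hH.1.comp_snd
      ((measurable_regKernel _).comp
        (measurable_snd.sub measurable_fst)).aestronglyMeasurable
  · refine Eventually.of_forall fun c => ?_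
    filter_upwards [hp.prod_right_ae] with x hx
    rw [norm_smul, mul_assoc]
    have h0 : 0 ≤ M := (norm_nonneg _).trans (hM 0)
    refine mul_le_mul (hM x) ?_ (norm_nonneg _) h0
    rw [← integral_const_mul]
    exact norm_integral_le_of_norm_le (hx.const_mul _)
      (Eventually.of_forall fun t => norm_hmul_regKernel_le H _ x t)
  · filter_upwards [hp.prod_right_ae] with x hx
    refine Tendsto.const_smul ?_ _
    refine tendsto_integral_filter_of_dominated_convergence _
      (Eventually.of_forall fun c => aestronglyMeasurable_hmul_regKernel hH.1 _ x)
      (Eventually.of_forall fun c => Eventually.of_forall fun t =>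
        norm_hmul_regKernel_le H _ x t) (hx.const_mul _) ?_
    refine Eventually.of_forall fun t => ?_
    exact ((hmulL (H t)).continuous.tendsto _).comp
      ((tendsto_regKernel (t - x)).comp tendsto_inv_atTop_zero)

/-- Fubini moves the mollifier from the merely integrable `F` onto the continuous `ψ`, where it
converges pointwise with the uniform bound `M * regMass`. -/
lemma tendsto_integral_integral_regDelta {G : Set E3} (hG : volume G ≠ ⊤) {F : E3 → HC}
    (hF : Integrable F (volume.restrict G)) {ψ : E3 → ℝ} (hψ : Continuous ψ)
    (hψc : HasCompactSupport ψ) (hψG : tsupport ψ ⊆ G) :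
    Tendsto (fun c : ℝ => ∫ x in G, ψ x • ∫ t in G, regDelta c⁻¹ (t - x) • F t) atTop
      (𝓝 (∫ t in G, ψ t • regMass • F t)) := by
  have : IsFiniteMeasure (volume.restrict G) := ⟨by simpa using hG.lt_top⟩
  obtain ⟨M, hM⟩ := hψ.bounded_above_of_compact_support hψc
  have h1 : ∀ c : ℝ, 0 < c → ∫ x in G, ψ x • ∫ t in G, regDelta c⁻¹ (t - x) • F t =
      ∫ t in G, (∫ x, ψ x * regDelta c⁻¹ (t - x)) • F t := by
    intro c hc
    simp only [← integral_smul]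
    rw [integral_integral_swap]
    · refine integral_congr_ae (Eventually.of_forall fun t => ?_)
      simp only [smul_smul]
      rw [integral_smul_const, setIntegral_eq_integral_of_forall_compl_eq_zero]
      intro x hx
      rw [image_eq_zero_of_notMem_tsupport fun h => hx (hψG h), zero_mul]
    · have hcont : Continuous fun p : E3 × E3 => ψ p.1 * regDelta c⁻¹ (p.2 - p.1) :=
        (hψ.comp continuous_fst).mul ((continuous_regDelta (inv_pos.2 hc).ne').comp
          (continuous_snd.sub continuous_fst))
      have hi : Integrable (fun p : E3 × E3 => F p.2)
          ((volume.restrict G).prod (volume.restrict G)) := hF.comp_snd _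
      have := hi.bdd_smul (M * (3 * c⁻¹ ^ 2 * (c⁻¹ ^ 2) ^ (-(5 / 2) : ℝ)))
        hcont.aestronglyMeasurable (Eventually.of_forall fun p => by
          rw [norm_mul, Real.norm_of_nonneg (regDelta_nonneg _ _)]
          exact mul_le_mul (hM _) (regDelta_le_const (inv_pos.2 hc) _) (regDelta_nonneg _ _)
            ((norm_nonneg _).trans (hM 0)))
      refine this.congr (Eventually.of_forall fun p => ?_)
      simp [Function.uncurry, smul_smul]
  have h2 : Tendsto (fun c : ℝ => ∫ t in G, (∫ x, ψ x * regDelta c⁻¹ (t - x)) • F t) atTop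
      (𝓝 (∫ t in G, (ψ t * regMass) • F t)) := by
    refine tendsto_integral_filter_of_dominated_convergence (fun t => M * regMass * ‖F t‖)
      ?_ ?_ (hF.norm.const_mul _) ?_
    · filter_upwards [eventually_gt_atTop 0] with c hc
      refine AEStronglyMeasurable.fun_smul ?_ hF.1
      have hcont : Continuous fun p : E3 × E3 => ψ p.2 * regDelta c⁻¹ (p.1 - p.2) :=
        (hψ.comp continuous_snd).mul ((continuous_regDelta (inv_pos.2 hc).ne').comp
          (continuous_fst.sub continuous_snd))
      exact AEStronglyMeasurable.integral_prod_right' hcont.aestronglyMeasurable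
    · filter_upwards [eventually_gt_atTop 0] with c hc
      refine Eventually.of_forall fun t => ?_
      rw [norm_smul]
      gcongr
      rw [← integral_regDelta_sub hc t, ← integral_const_mul]
      refine norm_integral_le_of_norm_le ((integrable_regDelta_sub hc t).const_mul _)
        (Eventually.of_forall fun x => ?_)
      rw [norm_mul, Real.norm_of_nonneg (regDelta_nonneg _ _)]
      exact mul_le_mul_of_nonneg_right (hM _) (regDelta_nonneg _ _)
    · exact Eventually.of_forall fun t => (tendsto_integral_regDelta hψ hψc t).smul_const _
  simp only [smul_smul]
  refine h2.congr' ?_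
  filter_upwards [eventually_gt_atTop 0] with c hc
  exact (h1 c hc).symm

/-- A function whose mollifications are regularised Cauchy transforms of `H` is the Cauchy
transform of `H`. -/
lemma ae_eq_cauchyTransform {G : Set E3} (hGo : IsOpen G) (hG : volume G ≠ ⊤) {F H : E3 → HC}
    (hF : Integrable F (volume.restrict G)) (hH : Integrable H (volume.restrict G))
    (h : ∀ ε, 0 < ε → ∀ x, ∫ t in G, regDelta ε (t - x) • F t =
      ∫ t in G, hmul (H t) (regKernel ε (t - x))) :
    ∀ᵐ x ∂volume.restrict G, regMass • F x = cauchyTransform G H x := by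
  have hR := integrable_cauchyTransform hG hH
  have hd : Integrable (fun x => regMass • F x - cauchyTransform G H x) (volume.restrict G) :=
    (hF.smul regMass).sub hR
  -- By the fundamental lemma of the calculus of variations it suffices to compare both sides
  -- against smooth `ψ` supported in `G`; there they are limits of the same quantity.
  have key := hGo.ae_eq_zero_of_integral_contDiff_smul_eq_zero (μ := volume)
    (f := fun x => regMass • F x - cauchyTransform G H x)
    (IntegrableOn.locallyIntegrableOn hd) ?_
  · filter_upwards [ae_restrict_of_ae key, ae_restrict_mem hGo.measurableSet] with x hx hxG
    exact sub_eq_zero.1 (hx hxG)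
  intro ψ hψ hψc hψG
  obtain ⟨M, hM⟩ := hψ.continuous.bounded_above_of_compact_support hψc
  have hb : ∀ {f : E3 → HC}, Integrable f (volume.restrict G) →
      Integrable (fun x => ψ x • f x) (volume.restrict G) := fun hf =>
    hf.bdd_smul M hψ.continuous.aestronglyMeasurable (Eventually.of_forall hM)
  rw [← setIntegral_eq_integral_of_forall_compl_eq_zero (s := G)]
  · simp only [smul_sub]
    rw [integral_sub (hb (hF.fun_smul regMass)) (hb hR), sub_eq_zero]
    refine tendsto_nhds_unique
      (tendsto_integral_integral_regDelta hG hF hψ.continuous hψc hψG) ?_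
    refine (tendsto_integral_regKernel hG hH hψ.continuous hψc).congr' ?_
    filter_upwards [eventually_gt_atTop 0] with c hc
    simp only [h _ (inv_pos.2 hc)]
  · intro x hx
    rw [image_eq_zero_of_notMem_tsupport fun h => hx (hψG h), zero_smul]

/-! ### Mapping properties of the Cauchy transform -/

lemma enorm_hmul_regKernel_le (H : E3 → HC) (x t : E3) :
    ‖hmul (H t) (regKernel 0 (t - x))‖ₑ ≤ hmulNorm * (‖H t‖ₑ * rieszKernel 2 (t - x)) := by
  rw [← ofReal_norm, ← ofReal_norm, rieszKernel, ← ENNReal.ofReal_mul (norm_nonneg _),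
    ← ENNReal.ofReal_coe_nnreal, ← ENNReal.ofReal_mul (by positivity)]
  exact ENNReal.ofReal_le_ofReal (norm_hmul_regKernel_le H 0 x t)

lemma enorm_cauchyTransform_le (G : Set E3) (H : E3 → HC) (x : E3) :
    ‖cauchyTransform G H x‖ₑ ≤ hmulNorm * ∫⁻ t in G, ‖H t‖ₑ * rieszKernel 2 (t - x) := by
  rw [← lintegral_const_mul' _ _ ENNReal.coe_ne_top]
  exact (enorm_integral_le_lintegral_enorm _).trans
    (lintegral_mono fun t => enorm_hmul_regKernel_le H x t)

lemma memLp_four_cauchyTransform {G : Set E3} (hG : volume G ≠ ⊤) {H : E3 → HC}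
    (hH : MemLp H 2 (volume.restrict G)) :
    MemLp (cauchyTransform G H) 4 (volume.restrict G) := by
  have : IsFiniteMeasure (volume.restrict G) := ⟨by simpa using hG.lt_top⟩
  refine ⟨(integrable_cauchyTransform hG (hH.integrable (by norm_num))).1, ?_⟩
  have h2 : ∫⁻ t in G, ‖H t‖ₑ ^ 2 ≠ ⊤ := by
    have := (eLpNorm_lt_top_iff_lintegral_rpow_enorm_lt_top (by norm_num) (by norm_num)).1 hH.2
    simpa using this.ne
  have h4 := lintegral_rieszPotential_pow_four_lt_top hG hH.1.enorm h2
  rw [eLpNorm_lt_top_iff_lintegral_rpow_enorm_lt_top (by norm_num) (by norm_num)]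
  refine lt_of_le_of_lt (b := (hmulNorm : ℝ≥0∞) ^ 4 *
    ∫⁻ x in G, (∫⁻ t in G, ‖H t‖ₑ * rieszKernel 2 (t - x)) ^ 4) ?_
    (ENNReal.mul_lt_top (ENNReal.pow_lt_top ENNReal.coe_lt_top) h4)
  rw [← lintegral_const_mul' _ _ (ENNReal.pow_ne_top ENNReal.coe_ne_top)]
  refine lintegral_mono fun x => ?_
  rw [← mul_pow]
  refine le_trans (le_of_eq ?_) (pow_le_pow_left' (enorm_cauchyTransform_le G H x) 4)
  simp only [ENNReal.toReal_ofNat]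
  norm_cast

/-- The Cauchy kernel, truncated near the origin to a continuous function. -/
def truncKernel (δ : ℝ) (z : E3) : HC := (max ‖z‖ δ) ^ (-3 : ℝ) • vecPart z

lemma continuous_truncKernel {δ : ℝ} (hδ : 0 < δ) : Continuous (truncKernel δ) := by
  unfold truncKernel
  refine Continuous.smul (Continuous.rpow_const (by fun_prop) fun z => Or.inl ?_) vecPart.continuous
  exact (lt_max_of_lt_right hδ).ne'

lemma regKernel_zero (z : E3) : regKernel 0 z = ‖z‖ ^ (-3 : ℝ) • vecPart z := by
  rw [regKernel]
  congr 1
  rw [zero_pow two_ne_zero, zero_add, ← Real.rpow_natCast, ← Real.rpow_mul (norm_nonneg z)]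
  norm_num

lemma norm_truncKernel_le {δ : ℝ} (hδ : 0 < δ) (z : E3) : ‖truncKernel δ z‖ ≤ δ ^ (-2 : ℝ) := by
  have h0 : 0 < max ‖z‖ δ := lt_max_of_lt_right hδ
  rw [truncKernel, norm_smul, norm_vecPart, Real.norm_of_nonneg (by positivity)]
  calc (max ‖z‖ δ) ^ (-3 : ℝ) * ‖z‖ ≤ (max ‖z‖ δ) ^ (-3 : ℝ) * max ‖z‖ δ := by
        gcongr; exact le_max_left _ _
    _ = (max ‖z‖ δ) ^ (-2 : ℝ) := by rw [← Real.rpow_add_one h0.ne']; norm_num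
    _ ≤ δ ^ (-2 : ℝ) :=
        Real.rpow_le_rpow_of_nonpos hδ (le_max_right _ _) (by norm_num)

/-- The difference lives on `|z| < δ`, where `|z|⁻² = |z|^(1/8) |z|^(-17/8)`. The first factor gives
smallness, and `17/8 < 9/4` keeps the second admissible for `L₄` densities. -/
lemma norm_regKernel_sub_truncKernel_le {δ : ℝ} (hδ : 0 < δ) (z : E3) :
    ‖regKernel 0 z - truncKernel δ z‖ ≤ δ ^ (1 / 8 : ℝ) * ‖z‖ ^ (-(17 / 8) : ℝ) := by
  rw [regKernel_zero, truncKernel, ← sub_smul, norm_smul, norm_vecPart]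
  rcases le_or_gt δ ‖z‖ with h | h
  · rw [max_eq_left h, sub_self, norm_zero, zero_mul]
    positivity
  rcases eq_or_ne z 0 with rfl | hz
  · simp
  have hz' : 0 < ‖z‖ := norm_pos_iff.2 hz
  rw [max_eq_right h.le]
  have h1 : δ ^ (-3 : ℝ) ≤ ‖z‖ ^ (-3 : ℝ) :=
    Real.rpow_le_rpow_of_nonpos hz' h.le (by norm_num)
  rw [Real.norm_of_nonneg (sub_nonneg.2 h1)]
  calc (‖z‖ ^ (-3 : ℝ) - δ ^ (-3 : ℝ)) * ‖z‖ ≤ ‖z‖ ^ (-3 : ℝ) * ‖z‖ := by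
        gcongr
        have : 0 ≤ δ ^ (-3 : ℝ) := by positivity
        linarith
    _ = ‖z‖ ^ (1 / 8 : ℝ) * ‖z‖ ^ (-(17 / 8) : ℝ) := by
        rw [← Real.rpow_add_one hz'.ne', ← Real.rpow_add hz']
        norm_num
    _ ≤ _ := by gcongr

/-- Truncating the kernel gives continuous functions of `x`, and the error is `O(δ^(1/8))` uniformly
in `x`, so the transform is a uniform limit of continuous functions. -/
lemma continuous_cauchyTransform {G : Set E3} (hG : volume G ≠ ⊤) {H : E3 → HC}
    (hH : MemLp H 4 (volume.restrict G)) : Continuous (cauchyTransform G H) := by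
  have : IsFiniteMeasure (volume.restrict G) := ⟨by simpa using hG.lt_top⟩
  have hHi : Integrable H (volume.restrict G) := hH.integrable (by norm_num)
  have h4 : ∫⁻ t in G, ‖H t‖ₑ ^ 4 ≠ ⊤ := by
    have := (eLpNorm_lt_top_iff_lintegral_rpow_enorm_lt_top (by norm_num) (by norm_num)).1 hH.2
    simp only [ENNReal.toReal_ofNat] at this
    refine ne_of_lt (lt_of_eq_of_lt (lintegral_congr fun t => ?_) this)
    norm_cast
  obtain ⟨C, hC, hC'⟩ := exists_rieszPotential_le hG hH.1.enorm h4 (s := 2) (by norm_num)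
    (by norm_num)
  obtain ⟨C2, hC2, hC2'⟩ := exists_rieszPotential_le hG hH.1.enorm h4 (s := 17 / 8) (by norm_num)
    (by norm_num)
  have hint : ∀ x, Integrable (fun t => hmul (H t) (regKernel 0 (t - x))) (volume.restrict G) := by
    intro x
    refine ⟨aestronglyMeasurable_hmul_regKernel hH.1 0 x, ?_⟩
    refine lt_of_le_of_lt (b := hmulNorm * C) ?_ (ENNReal.mul_lt_top ENNReal.coe_lt_top hC.lt_top)
    refine le_trans ?_ (mul_le_mul_right (hC' x) _)
    rw [← lintegral_const_mul' _ _ ENNReal.coe_ne_top]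
    exact lintegral_mono fun t => enorm_hmul_regKernel_le H x t
  have hmeas : ∀ δ : ℝ, 0 < δ → ∀ x, AEStronglyMeasurable
      (fun t => hmul (H t) (truncKernel δ (t - x))) (volume.restrict G) := fun δ hδ x =>
    hmulL.aestronglyMeasurable_comp₂ hH.1
      ((continuous_truncKernel hδ).comp (continuous_id.sub continuous_const)).aestronglyMeasurable
  have hbd : ∀ δ : ℝ, 0 < δ → ∀ x t, ‖hmul (H t) (truncKernel δ (t - x))‖ ≤
      hmulNorm * ‖H t‖ * δ ^ (-2 : ℝ) := fun δ hδ x t =>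
    (norm_hmul_le _ _).trans (by gcongr; exact norm_truncKernel_le hδ _)
  have hbi : ∀ δ : ℝ, Integrable (fun t => hmulNorm * ‖H t‖ * δ ^ (-2 : ℝ))
      (volume.restrict G) := fun δ => (hHi.norm.const_mul _).mul_const _
  have hcont : ∀ δ : ℝ, 0 < δ →
      Continuous fun x => ∫ t in G, hmul (H t) (truncKernel δ (t - x)) := by
    intro δ hδ
    refine continuous_of_dominated (hmeas δ hδ)
      (fun x => Eventually.of_forall (hbd δ hδ x)) (hbi δ) (Eventually.of_forall fun t => ?_)
    exact (hmulL (H t)).continuous.comp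
      ((continuous_truncKernel hδ).comp (continuous_const.sub continuous_id))
  have hdiff : ∀ δ : ℝ, 0 < δ → ∀ x,
      ‖cauchyTransform G H x - ∫ t in G, hmul (H t) (truncKernel δ (t - x))‖ ≤
        δ ^ (1 / 8 : ℝ) * (hmulNorm * C2.toReal) := by
    intro δ hδ x
    rw [cauchyTransform, ← integral_sub (hint x)
      ((hbi δ).mono' (hmeas δ hδ x) (Eventually.of_forall (hbd δ hδ x)))]
    have hnn : 0 ≤ δ ^ (1 / 8 : ℝ) * (hmulNorm * C2.toReal) := by positivity
    rw [← toReal_enorm]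
    refine ENNReal.toReal_le_of_le_ofReal hnn ?_
    rw [ENNReal.ofReal_mul (by positivity), ENNReal.ofReal_mul (by positivity),
      ENNReal.ofReal_toReal hC2]
    refine (enorm_integral_le_lintegral_enorm _).trans ?_
    refine le_trans ?_ (mul_le_mul_right (mul_le_mul_right (hC2' x) _) _)
    rw [← lintegral_const_mul' _ _ ENNReal.ofReal_ne_top,
      ← lintegral_const_mul' _ _ ENNReal.ofReal_ne_top]
    refine lintegral_mono fun t => ?_
    rw [← hmul_sub_right, rieszKernel, ← ofReal_norm (H t), ← ENNReal.ofReal_mul (norm_nonneg _),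
      ← ENNReal.ofReal_mul (by positivity), ← ENNReal.ofReal_mul (by positivity), ← ofReal_norm]
    refine ENNReal.ofReal_le_ofReal ((norm_hmul_le _ _).trans ?_)
    calc hmulNorm * ‖H t‖ * ‖regKernel 0 (t - x) - truncKernel δ (t - x)‖
        ≤ hmulNorm * ‖H t‖ * (δ ^ (1 / 8 : ℝ) * ‖t - x‖ ^ (-(17 / 8) : ℝ)) := by
          gcongr
          exact norm_regKernel_sub_truncKernel_le hδ _
      _ = _ := by ring
  have hu : TendstoUniformly (fun (δ : ℝ) x => ∫ t in G, hmul (H t) (truncKernel δ (t - x)))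
      (cauchyTransform G H) (𝓝[>] 0) := by
    rw [Metric.tendstoUniformly_iff]
    intro ε hε
    have hlim : Tendsto (fun δ : ℝ => δ ^ (1 / 8 : ℝ) * (hmulNorm * C2.toReal)) (𝓝[>] 0) (𝓝 0) := by
      have h : ContinuousAt (fun δ : ℝ => δ ^ (1 / 8 : ℝ) * (hmulNorm * C2.toReal)) 0 :=
        (Real.continuousAt_rpow_const _ _ (Or.inr (by norm_num))).mul continuousAt_const
      have h' := h.tendsto.mono_left (nhdsWithin_le_nhds (s := Set.Ioi 0))
      simpa using h'
    filter_upwards [hlim.eventually (gt_mem_nhds hε), self_mem_nhdsWithin] with δ h1 h2 x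
    rw [dist_eq_norm]
    exact (hdiff δ h2 x).trans_lt h1
  refine hu.continuous (Eventually.frequently ?_)
  filter_upwards [self_mem_nhdsWithin] with δ hδ using hcont δ hδ

/-! ### Regularity of weak solutions -/

lemma MemLp.hmul_of_bound {μ : Measure E3} {p : ℝ≥0∞} {f g : E3 → HC} {M : ℝ} (hf : MemLp f p μ)
    (hg : AEStronglyMeasurable g μ) (hM : ∀ t, ‖g t‖ ≤ M) :
    MemLp (fun t => hmul (f t) (g t)) p μ := by
  refine hf.of_le_mul (c := hmulNorm * M) (hmulL.aestronglyMeasurable_comp₂ hf.1 hg)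
    (Eventually.of_forall fun t => (norm_hmul_le _ _).trans ?_)
  rw [mul_right_comm]
  gcongr
  exact hM t

lemma MemLp.real_smul_of_bound {μ : Measure E3} {p : ℝ≥0∞} {f : E3 → HC} {g : E3 → ℝ} {M : ℝ}
    (hf : MemLp f p μ) (hg : AEStronglyMeasurable g μ) (hM : ∀ t, ‖g t‖ ≤ M) :
    MemLp (fun t => g t • f t) p μ := by
  refine hf.of_le_mul (c := M) (hg.smul hf.1) (Eventually.of_forall fun t => ?_)
  rw [norm_smul]
  gcongr
  exact hM t

lemma MemLp.hconj {μ : Measure E3} {p : ℝ≥0∞} {f : E3 → HC} (hf : MemLp f p μ) :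
    MemLp (fun t => hconj (f t)) p μ :=
  hconjL.comp_memLp' hf

/-- The density of the Cauchy transform that represents the function `η w̄`, for a cutoff function
`η` and a function `w` with weak Dirac derivative `v`. -/
def cutoffDensity (η : E3 → ℝ) (w v : E3 → HC) (t : E3) : HC :=
  hmul (hconj (w t)) (hgrad η t) - η t • hconj (v t)

lemma exists_bound_hgrad {η : E3 → ℝ} (hη : ContDiff ℝ ∞ η) (hηc : HasCompactSupport η) :
    ∃ M, ∀ t, ‖hgrad η t‖ ≤ M := by
  refine (continuous_hgrad hη).bounded_above_of_compact_support (hηc.mono' ?_)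
  exact Function.support_subset_iff'.2 fun t ht => hgrad_eq_zero ht

lemma memLp_cutoffDensity {μ : Measure E3} {p : ℝ≥0∞} {η : E3 → ℝ} (hη : ContDiff ℝ ∞ η)
    (hηc : HasCompactSupport η) {w v : E3 → HC} (hw : MemLp w p μ) (hv : MemLp v p μ) :
    MemLp (cutoffDensity η w v) p μ := by
  obtain ⟨M, hM⟩ := exists_bound_hgrad hη hηc
  obtain ⟨M', hM'⟩ := hη.continuous.bounded_above_of_compact_support hηc
  exact (MemLp.hmul_of_bound (MemLp.hconj hw) (continuous_hgrad hη).aestronglyMeasurable hM).sub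
    (MemLp.real_smul_of_bound (MemLp.hconj hv) hη.continuous.aestronglyMeasurable hM')

/-- The weak equation is tested with the cut-off regularised kernel. The derivative falling on `η`
produces the `hgrad` term of the density, and the one falling on the kernel produces the mollifier.
-/
lemma IsWeakDirac.integral_regDelta_eq {G : Set E3} {w v : E3 → HC} (h : IsWeakDirac G w v)
    (hw : Integrable w (volume.restrict G)) (hv : Integrable v (volume.restrict G))
    {η : E3 → ℝ} (hη : ContDiff ℝ ∞ η) (hηc : HasCompactSupport η) (hηG : tsupport η ⊆ G)
    {ε : ℝ} (hε : 0 < ε) (x : E3) :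
    ∫ t in G, regDelta ε (t - x) • (η t • hconj (w t)) =
      ∫ t in G, hmul (cutoffDensity η w v t) (regKernel ε (t - x)) := by
  rw [← memLp_one_iff_integrable] at hw hv
  obtain ⟨M, hM⟩ := exists_bound_hgrad hη hηc
  obtain ⟨M', hM'⟩ := hη.continuous.bounded_above_of_compact_support hηc
  have hK : Continuous fun t : E3 => regKernel ε (t - x) :=
    (contDiff_regKernel hε.ne' x).continuous
  have hφ : IsTest G fun t => η t • regKernel ε (t - x) :=
    ⟨hη.smul (contDiff_regKernel hε.ne' x), hηc.smul_right,
      (tsupport_smul_subset_left _ _).trans hηG⟩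
  have heq := h.integral_eq _ hφ
  have hB : Integrable (fun t => regDelta ε (t - x) • (η t • hconj (w t)))
      (volume.restrict G) := by
    rw [← memLp_one_iff_integrable]
    refine MemLp.real_smul_of_bound (M := 3 * ε ^ 2 * (ε ^ 2) ^ (-(5 / 2) : ℝ))
      (MemLp.real_smul_of_bound (MemLp.hconj hw) hη.continuous.aestronglyMeasurable hM')
      ((continuous_regDelta hε.ne').comp
        (continuous_id.sub continuous_const)).aestronglyMeasurable fun t => ?_
    rw [Real.norm_of_nonneg (regDelta_nonneg _ _)]
    exact regDelta_le_const hε _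
  have hA : Integrable (fun t => hmul (hmul (hconj (w t)) (hgrad η t)) (regKernel ε (t - x)))
      (volume.restrict G) := by
    rw [← memLp_one_iff_integrable]
    exact MemLp.hmul_of_bound (MemLp.hmul_of_bound (MemLp.hconj hw)
      (continuous_hgrad hη).aestronglyMeasurable hM) hK.aestronglyMeasurable
      fun t => norm_regKernel_le_const ε hε _
  have hC : Integrable (fun t => hmul (η t • hconj (v t)) (regKernel ε (t - x)))
      (volume.restrict G) := by
    rw [← memLp_one_iff_integrable]
    exact MemLp.hmul_of_bound (MemLp.real_smul_of_bound (MemLp.hconj hv)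
      hη.continuous.aestronglyMeasurable hM') hK.aestronglyMeasurable
      fun t => norm_regKernel_le_const ε hε _
  have h1 : ∀ t, hmul (hconj (w t)) (dirac (fun t => η t • regKernel ε (t - x)) t) =
      hmul (hmul (hconj (w t)) (hgrad η t)) (regKernel ε (t - x)) -
        regDelta ε (t - x) • (η t • hconj (w t)) := by
    intro t
    rw [dirac_smul (hη.differentiable (by simp) t)
      ((contDiff_regKernel hε.ne' x).differentiable (by simp) t), dirac_regKernel hε.ne',
      hmul_add_right, hmul_assoc, hmul_smul_right, ← neg_smul, hmul_smul_right, hmul_eUnit_zero,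
      smul_smul, smul_smul, mul_neg, neg_smul, ← sub_eq_add_neg, mul_comm (η t)]
  simp only [h1, hmul_smul_right] at heq
  simp only [cutoffDensity, hmul_sub_left]
  rw [integral_sub hA hB] at heq
  rw [integral_sub hA hC]
  simp only [hmul_smul_left]
  rw [← heq]
  abel

lemma memLp_vekuaQ {G : Set E3} (A : Fin 4 → LInf G) {p : ℝ≥0∞} {w : E3 → HC}
    (hw : MemLp w p (volume.restrict G)) :
    MemLp (vekuaQ (fun j => A j) w) p (volume.restrict G) :=
  (((hmulL.memLp_of_bilin p hw (Lp.memLp (A 0))).add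
    (hmulL.memLp_of_bilin p (MemLp.hconj hw) (Lp.memLp (A 1)))).add
    (hmulL.memLp_of_bilin p (Lp.memLp (A 2)) hw)).add
    (hmulL.memLp_of_bilin p (Lp.memLp (A 3)) (MemLp.hconj hw))

lemma IsWeakSolution.ae_smul_hconj_eq {G : Set E3} (hGo : IsOpen G) (hG : volume G ≠ ⊤)
    {A : Fin 4 → LInf G} {w : E3 → HC} (h : IsWeakSolution G A w)
    (hw : MemLp w 2 (volume.restrict G)) {η : E3 → ℝ} (hη : ContDiff ℝ ∞ η)
    (hηc : HasCompactSupport η) (hηG : tsupport η ⊆ G) :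
    ∀ᵐ x ∂volume.restrict G, regMass • (η x • hconj (w x)) =
      cauchyTransform G (cutoffDensity η w (vekuaQ (fun j => A j) w)) x := by
  have : IsFiniteMeasure (volume.restrict G) := ⟨by simpa using hG.lt_top⟩
  have hv := memLp_vekuaQ A hw
  obtain ⟨M', hM'⟩ := hη.continuous.bounded_above_of_compact_support hηc
  refine ae_eq_cauchyTransform hGo hG ?_ ?_ fun ε hε x => ?_
  · exact (MemLp.real_smul_of_bound (MemLp.hconj hw) hη.continuous.aestronglyMeasurable
      hM').integrable (by norm_num)
  · exact (memLp_cutoffDensity hη hηc hw hv).integrable (by norm_num)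
  · exact IsWeakDirac.integral_regDelta_eq h (hw.integrable (by norm_num))
      (hv.integrable (by norm_num)) hη hηc hηG hε x

lemma IsWeakSolution.memLp_four_smul {G : Set E3} (hGo : IsOpen G) (hG : volume G ≠ ⊤)
    {A : Fin 4 → LInf G} {w : E3 → HC} (h : IsWeakSolution G A w)
    (hw : MemLp w 2 (volume.restrict G)) {η : E3 → ℝ} (hη : ContDiff ℝ ∞ η)
    (hηc : HasCompactSupport η) (hηG : tsupport η ⊆ G) :
    MemLp (fun x => η x • w x) 4 (volume.restrict G) := by
  have h1 := memLp_four_cauchyTransform hG (memLp_cutoffDensity hη hηc hw (memLp_vekuaQ A hw))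
  refine ((MemLp.hconj h1).const_smul regMass⁻¹).ae_eq ?_
  filter_upwards [h.ae_smul_hconj_eq hGo hG hw hη hηc hηG] with x hx
  simp only [Pi.smul_apply, ← hx, hconj_smul, hconj_hconj]
  rw [inv_smul_smul₀ regMass_pos.ne']

/-- The density for the inner cutoff sees `w` only where the outer cutoff is `1`, so the
integrability gained for `η w` carries over to it. -/
lemma cutoffDensity_eq_of_eq_one {a : Fin 4 → E3 → HC} {η η' : E3 → ℝ}
    (hη : ∀ t ∈ tsupport η', η t = 1) (w : E3 → HC) :
    cutoffDensity η' w (vekuaQ a w) =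
      cutoffDensity η' (fun t => η t • w t) (vekuaQ a fun t => η t • w t) := by
  ext1 t
  by_cases ht : t ∈ tsupport η'
  · simp only [cutoffDensity, vekuaQ, hη t ht, one_smul]
  · simp only [cutoffDensity, hgrad_eq_zero ht, image_eq_zero_of_notMem_tsupport ht, zero_smul,
      ← hmulL_apply, map_zero]

/-- Weak solutions in `L₂` are continuous near each point. -/
lemma IsWeakSolution.exists_continuous_ae_eq_ball {G : Set E3} (hGo : IsOpen G)
    (hG : volume G ≠ ⊤) {A : Fin 4 → LInf G} {w : E3 → HC} (h : IsWeakSolution G A w)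
    (hw : MemLp w 2 (volume.restrict G)) {x₀ : E3} (hx₀ : x₀ ∈ G) :
    ∃ r > 0, Metric.ball x₀ r ⊆ G ∧ ∃ g : E3 → HC, Continuous g ∧
      g =ᵐ[volume.restrict (Metric.ball x₀ r)] w := by
  obtain ⟨R, hR, hRG⟩ := Metric.isOpen_iff.1 hGo x₀ hx₀
  -- The outer cutoff `b` equals `1` on the ball of radius `R/2` that supports the inner cutoff
  -- `b'`; in turn `b'` equals `1` on the final ball of radius `R/4`.
  let b : ContDiffBump x₀ := ⟨R / 2, 3 * R / 4, by linarith, by linarith⟩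
  let b' : ContDiffBump x₀ := ⟨R / 4, R / 2, by linarith, by linarith⟩
  have hb1 : ∀ t ∈ tsupport b', b t = 1 := fun t ht => by
    rw [b'.tsupport_eq] at ht
    exact b.one_of_mem_closedBall ht
  have hbG : tsupport b ⊆ G := by
    rw [b.tsupport_eq]
    exact (Metric.closedBall_subset_ball (by change 3 * R / 4 < R; linarith)).trans hRG
  have hbG' : tsupport b' ⊆ G := by
    rw [b'.tsupport_eq]
    exact (Metric.closedBall_subset_ball (by change R / 2 < R; linarith)).trans hRG
  have h4 := h.memLp_four_smul hGo hG hw b.contDiff b.hasCompactSupport hbG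
  have hcont := continuous_cauchyTransform hG
    (memLp_cutoffDensity b'.contDiff b'.hasCompactSupport h4 (memLp_vekuaQ A h4))
  rw [← cutoffDensity_eq_of_eq_one hb1] at hcont
  have hsub : Metric.ball x₀ (R / 4) ⊆ G :=
    (Metric.ball_subset_ball (by linarith)).trans hRG
  refine ⟨R / 4, by linarith, hsub, _, hconjL.continuous.comp (hcont.const_smul regMass⁻¹), ?_⟩
  filter_upwards [ae_restrict_of_ae_restrict_of_subset hsub
    (h.ae_smul_hconj_eq hGo hG hw b'.contDiff b'.hasCompactSupport hbG'),
    ae_restrict_mem measurableSet_ball] with x hx hxb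
  have h1 : b' x = 1 := b'.one_of_mem_closedBall (Metric.ball_subset_closedBall hxb)
  simp only [Function.comp_apply, Pi.smul_apply, ← hx, h1, one_smul, inv_smul_smul₀ regMass_pos.ne', hconjL_apply,
    hconj_hconj]

/-! ### Continuous representatives -/

/-- Continuous functions that agree almost everywhere on an open set agree on it, so the local
representatives coincide on overlaps and the diagonal `y ↦ g y y` is continuous. -/
lemma exists_continuousOn_ae_eq_of_locally {G : Set E3} {w : E3 → HC}
    (h : ∀ x ∈ G, ∃ r > 0, Metric.ball x r ⊆ G ∧ ∃ g : E3 → HC, Continuous g ∧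
      g =ᵐ[volume.restrict (Metric.ball x r)] w) (hG : MeasurableSet G) :
    ∃ f : E3 → HC, ContinuousOn f G ∧ f =ᵐ[volume.restrict G] w := by
  choose! r hr hsub g hg hgw using h
  have hgg : ∀ x ∈ G, ∀ y ∈ Metric.ball x (r x), g y y = g x y := by
    intro x hx y hy
    have hyG := hsub x hx hy
    have he : g y =ᵐ[volume.restrict (Metric.ball x (r x) ∩ Metric.ball y (r y))] g x := by
      filter_upwards [ae_restrict_of_ae_restrict_of_subset Set.inter_subset_right (hgw y hyG),
        ae_restrict_of_ae_restrict_of_subset Set.inter_subset_left (hgw x hx)] with t h1 h2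
      rw [h1, h2]
    exact Measure.eqOn_open_of_ae_eq he (Metric.isOpen_ball.inter Metric.isOpen_ball)
      (hg y hyG).continuousOn (hg x hx).continuousOn ⟨hy, Metric.mem_ball_self (hr y hyG)⟩
  refine ⟨fun y => g y y, fun x hx => ?_, ?_⟩
  · refine ((hg x hx).continuousAt.congr ?_).continuousWithinAt
    filter_upwards [Metric.ball_mem_nhds x (hr x hx)] with y hy using (hgg x hx y hy).symm
  · rw [EventuallyEq, ae_restrict_iff' hG, ae_iff]
    refine measure_null_of_locally_null _ fun x hx => ?_
    have hxG : x ∈ G := by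
      by_contra hxG
      exact hx fun h => absurd h hxG
    refine ⟨_ ∩ Metric.ball x (r x), inter_mem self_mem_nhdsWithin
      (mem_nhdsWithin_of_mem_nhds (Metric.ball_mem_nhds x (hr x hxG))), ?_⟩
    refine measure_mono_null (fun y hy => ?_)
      (ae_iff.1 ((ae_restrict_iff' measurableSet_ball).1 (hgw x hxG)))
    intro h
    exact hy.1 fun _ => (hgg x hxG y hy.2).trans (h hy.2)

variable {G : Set E3} {A : Fin 4 → LInf G}

lemma contRep_spec (hGo : IsOpen G) (hG : volume G ≠ ⊤) (w : vekuaSpace G A) :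
    ContinuousOn (contRep (w : L2 G)) G ∧
      contRep (w : L2 G) =ᵐ[volume.restrict G] (w : L2 G) := by
  have h : ∃ f : E3 → HC, ContinuousOn f G ∧ f =ᵐ[volume.restrict G] (w : L2 G) :=
    exists_continuousOn_ae_eq_of_locally (fun x hx =>
      IsWeakSolution.exists_continuous_ae_eq_ball hGo hG w.2 (Lp.memLp _) hx) hGo.measurableSet
  rw [contRep, dif_pos h]
  exact h.choose_spec

lemma eqOn_contRep (hGo : IsOpen G) (hG : volume G ≠ ⊤) (w : vekuaSpace G A) {f : E3 → HC}
    (hf : ContinuousOn f G) (hfw : f =ᵐ[volume.restrict G] (w : L2 G)) :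
    Set.EqOn f (contRep (w : L2 G)) G :=
  Measure.eqOn_open_of_ae_eq (hfw.trans (contRep_spec hGo hG w).2.symm) hGo hf
    (contRep_spec hGo hG w).1

/-! ### Point evaluations -/

/-- The average over a measurable set as a bounded linear map on `L₂(G; ℍ_ℂ)`. -/
def averageL (G : Set E3) [IsFiniteMeasure (volume.restrict G)] {s : Set E3}
    (hs : MeasurableSet s) : L2 G →L[ℂ] HC :=
  (((volume.restrict G).real s)⁻¹ : ℂ) • hmulL.lpPairing (volume.restrict G) 2 2
    (indicatorConstLp 2 hs (measure_ne_top _ s) (eUnit 0))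

lemma averageL_apply (G : Set E3) [IsFiniteMeasure (volume.restrict G)] {s : Set E3}
    (hs : MeasurableSet s) (w : L2 G) :
    averageL G hs w = ⨍ t in s, w t ∂(volume.restrict G) := by
  rw [setAverage_eq, averageL, smul_apply, ContinuousLinearMap.lpPairing_eq_integral,
    ← integral_indicator hs]
  have h : ∫ t in G, hmulL (indicatorConstLp 2 hs (measure_ne_top (volume.restrict G) s)
      (eUnit 0) t) (w t) = ∫ t in G, s.indicator w t := by
    refine integral_congr_ae ?_
    filter_upwards [indicatorConstLp_coeFn (p := 2) (hs := hs)
      (hμs := measure_ne_top (volume.restrict G) s) (c := eUnit 0)] with t ht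
    rw [ht]
    by_cases hts : t ∈ s
    · simp only [hts, Set.indicator_of_mem, hmulL_apply]
      ext i
      fin_cases i <;> simp [hmul_eq, eUnit]
    · simp [hts]
  rw [h, ← Complex.ofReal_inv]
  exact Complex.coe_smul _ _

lemma tendsto_average_contRep (hGo : IsOpen G) (hG : volume G ≠ ⊤)
    [IsFiniteMeasure (volume.restrict G)] (w : vekuaSpace G A) {x : E3} (hx : x ∈ G) :
    Tendsto (fun n : ℕ => ⨍ t in Metric.ball x (1 / (n + 1)), (w : L2 G) t ∂(volume.restrict G))
      atTop (𝓝 (contRep (w : L2 G) x)) := by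
  obtain ⟨hc, hae⟩ := contRep_spec hGo hG w
  have hcx : ContinuousAt (contRep (w : L2 G)) x := hc.continuousAt (hGo.mem_nhds hx)
  refine Metric.nhds_basis_closedBall.tendsto_right_iff.2 fun ε hε => ?_
  obtain ⟨δ, hδ, hδ'⟩ := Metric.mem_nhds_iff.1 (hcx (Metric.closedBall_mem_nhds _ hε))
  filter_upwards [tendsto_one_div_add_atTop_nhds_zero_nat.eventually (gt_mem_nhds hδ)] with n hn
  have hn0 : (0 : ℝ) < 1 / (n + 1) := by positivity
  refine (convex_closedBall _ _).set_average_mem Metric.isClosed_closedBall ?_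
    (measure_ne_top _ _) ?_ ?_
  · rw [Measure.restrict_apply measurableSet_ball]
    exact ((Metric.isOpen_ball.inter hGo).measure_pos _ ⟨x, Metric.mem_ball_self hn0, hx⟩).ne'
  · filter_upwards [ae_restrict_of_ae hae, ae_restrict_mem measurableSet_ball] with t ht htb
    rw [← ht]
    exact hδ' (Metric.ball_subset_ball hn.le htb)
  · exact ((Lp.memLp (w : L2 G)).integrable (by norm_num)).integrableOn

/-- Evaluation is a pointwise limit of bounded averaging operators on a Banach space, hence bounded
by Banach-Steinhaus. No quantitative interior estimate is required. -/
lemma exists_evaluation (hGo : IsOpen G) (hG : volume G ≠ ⊤) {x : E3} (hx : x ∈ G) :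
    ∃ ev : vekuaSpace G A →L[ℂ] HC, ∀ w, ev w = contRep (w : L2 G) x := by
  have : IsFiniteMeasure (volume.restrict G) := ⟨by simpa using hG.lt_top⟩
  let L : ℕ → vekuaSpace G A →L[ℂ] HC := fun n =>
    (averageL G (measurableSet_ball (x := x) (ε := 1 / (n + 1)))).comp (vekuaSpace G A).subtypeL
  have hL : Tendsto (fun n w => L n w) atTop
      (𝓝 fun w : vekuaSpace G A => contRep (w : L2 G) x) := by
    rw [tendsto_pi_nhds]
    intro w
    refine (tendsto_average_contRep hGo hG w hx).congr fun n => ?_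
    exact (averageL_apply G _ _).symm
  exact ⟨continuousLinearMapOfTendsto L hL, fun w => rfl⟩

/-! ### Reproducing kernels -/

lemma contRep_apply_eq_inner (hGo : IsOpen G) (hG : volume G ≠ ⊤) {x : E3} (hx : x ∈ G)
    (k : Fin 4) (w : vekuaSpace G A) :
    contRep (w : L2 G) x k = inner ℂ (compKernel G A x k : L2 G) (w : L2 G) := by
  have h : ∃ K : vekuaSpace G A, ∀ w : vekuaSpace G A,
      contRep (w : L2 G) x k = inner ℂ (K : L2 G) (w : L2 G) := by
    obtain ⟨ev, hev⟩ := exists_evaluation (A := A) hGo hG hx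
    refine ⟨(InnerProductSpace.toDual ℂ (vekuaSpace G A)).symm
      ((EuclideanSpace.proj k : HC →L[ℂ] ℂ).comp ev), fun w => ?_⟩
    rw [← Submodule.coe_inner, InnerProductSpace.toDual_symm_apply, ContinuousLinearMap.comp_apply,
      hev]
    rfl
  rw [compKernel, dif_pos h]
  exact h.choose_spec w

lemma eq_compKernel (hGo : IsOpen G) (hG : volume G ≠ ⊤) {x : E3} (hx : x ∈ G) (k : Fin 4)
    {K : vekuaSpace G A}
    (hK : ∀ w : vekuaSpace G A, contRep (w : L2 G) x k = inner ℂ (K : L2 G) (w : L2 G)) :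
    K = compKernel G A x k := by
  refine ext_inner_right ℂ fun w => ?_
  rw [Submodule.coe_inner, Submodule.coe_inner, ← hK w, contRep_apply_eq_inner hGo hG hx]

/-- Hermitian symmetry of the kernels exchanges the roles of `x` and `t`. As a function of `t` the
kernel is then governed by one fixed `L₂` element, which yields measurability and integrability in
`t`. -/
lemma vekuaKernel_apply (hGo : IsOpen G) (hG : volume G ≠ ⊤) {x t : E3} (hx : x ∈ G)
    (ht : t ∈ G) (a : HC) (k : Fin 4) :
    vekuaKernel G A x t a k = inner ℂ (contRep (compKernel G A x k : L2 G) t) a := by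
  have h : ∀ j, contRep (compKernel G A t j : L2 G) x k =
      starRingEnd ℂ (contRep (compKernel G A x k : L2 G) t j) := fun j => by
    rw [contRep_apply_eq_inner hGo hG hx, contRep_apply_eq_inner hGo hG ht, inner_conj_symm]
  simp [vekuaKernel, PiLp.inner_apply, h]

lemma ae_vekuaKernel_apply (hGo : IsOpen G) (hG : volume G ≠ ⊤) (u : L2 G) {x : E3} (hx : x ∈ G)
    (k : Fin 4) :
    (fun t => inner ℂ ((compKernel G A x k : L2 G) t) (u t)) =ᵐ[volume.restrict G]
      fun t => vekuaKernel G A x t (u t) k := by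
  filter_upwards [(contRep_spec hGo hG (compKernel G A x k)).2,
    ae_restrict_mem hGo.measurableSet] with t ht htG
  rw [vekuaKernel_apply hGo hG hx htG, ht]

lemma integrable_vekuaKernel (hGo : IsOpen G) (hG : volume G ≠ ⊤) (u : L2 G) {x : E3}
    (hx : x ∈ G) : Integrable (fun t => vekuaKernel G A x t (u t)) (volume.restrict G) := by
  refine Integrable.of_eval_piLp fun k => ?_
  exact (L2.integrable_inner (compKernel G A x k : L2 G) u).congr
    (ae_vekuaKernel_apply hGo hG u hx k)

lemma contRep_vekuaProj (hGo : IsOpen G) (hG : volume G ≠ ⊤) (u : L2 G) {x : E3} (hx : x ∈ G) :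
    contRep (vekuaProj G A u : L2 G) x = ∫ t in G, vekuaKernel G A x t (u t) := by
  have hint := integrable_vekuaKernel (A := A) hGo hG u hx
  ext k
  -- Since `K_x^k` lies in the subspace, the projection can be dropped from the inner product.
  rw [contRep_apply_eq_inner hGo hG hx, vekuaProj, ← Submodule.coe_inner,
    Submodule.inner_orthogonalProjectionOnto_eq_of_mem_left, L2.inner_def,
    integral_congr_ae (ae_vekuaKernel_apply hGo hG u hx k)]
  exact (EuclideanSpace.proj k : HC →L[ℂ] ℂ).integral_comp_comm hint

end VekuaBergman

end

theorem mainTheorem6 (G : Set E3) (hGo : IsOpen G) (hGc : IsConnected G)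
    (hGb : Bornology.IsBounded G) (A : Fin 4 → LInf G) :
    -- every element of the space has a continuous representative, unique on `G`
    (∀ w : vekuaSpace G A,
      ContinuousOn (contRep (w : L2 G)) G ∧
      contRep (w : L2 G) =ᵐ[volume.restrict G] (w : L2 G) ∧
      ∀ f : E3 → HC, ContinuousOn f G →
        f =ᵐ[volume.restrict G] (w : L2 G) →
        Set.EqOn f (contRep (w : L2 G)) G) ∧
    -- point evaluations are linear and bounded
    (∀ x ∈ G, ∃ ev : vekuaSpace G A →L[ℂ] HC,
      ∀ w, ev w = contRep (w : L2 G) x) ∧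
    -- the component kernels are the unique elements of the space that reproduce the components
    (∀ x ∈ G, ∀ k : Fin 4,
      (∀ w : vekuaSpace G A, contRep (w : L2 G) x k =
        inner ℂ (compKernel G A x k : L2 G) (w : L2 G)) ∧
      ∀ K : vekuaSpace G A,
        (∀ w : vekuaSpace G A, contRep (w : L2 G) x k =
          inner ℂ (K : L2 G) (w : L2 G)) →
        K = compKernel G A x k) ∧
    -- the kernel formula for the orthogonal projection
    (∀ u : L2 G, ∀ x ∈ G,
      Integrable (fun t => vekuaKernel G A x t (u t)) (volume.restrict G) ∧
      contRep (vekuaProj G A u : L2 G) x =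
        ∫ t in G, vekuaKernel G A x t (u t)) := by
  have hG : volume G ≠ ⊤ := hGb.measure_lt_top.ne
  refine ⟨fun w => ⟨(contRep_spec hGo hG w).1, (contRep_spec hGo hG w).2,
      fun f hf hfw => eqOn_contRep hGo hG w hf hfw⟩,
    fun x hx => exists_evaluation hGo hG hx,
    fun x hx k => ⟨contRep_apply_eq_inner hGo hG hx k, fun K hK => eq_compKernel hGo hG hx k hK⟩,
    fun u x hx => ⟨integrable_vekuaKernel hGo hG u hx, contRep_vekuaProj hGo hG u hx⟩⟩
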